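/- Theorem (Hopf–Rinow in finite factors). Let $\mathcal A\subset B(\mathcal H)$ be a finite von Neumann factor with a faithful normal trace $\tau$, let $\mathcal P_{\mathcal A}$ be the set of selfadjoint projections of $\mathcal A$ with the norm topology, and let $p,q\in\mathcal P_{\mathcal A}$. Then the following are equivalent: (a) $p\sim q$, i.e. there is $v\in\mathcal A$ with $v^*v=p$ and $vv^*=q$; (b) there is a unitary $u\in\mathcal A$ with $upu^*=q$; (c) $\tau(p)=\tau(q)$; (d) $p$ and $q$ lie in the same connected component of $\mathcal P_{\mathcal A}$. If they hold, then $\tau(p\wedge q^\perp)=\tau(p^\perp\wedge q)$, where $r^\perp=1-r$ and $r\wedge s$ is the projection onto $R(r)\cap R(s)$, and $p$ and $q$ can be joined by a normalized geodesic of $\mathcal P_{\mathcal A}$ that is minimal. That is, there is $z\in\mathcal A$ with $z^*=-z$, $pzp=0=p^\perp zp^\perp$ and $\|z\|\le\pi/2$ such that $\delta(t)=e^{tz}pe^{-tz}$ satisfies $\delta(0)=p$ and $\delta(1)=q$, $\delta$ is a geodesic of $\mathcal P_{\mathcal A}$ with $\|\dot\delta(0)\|\le\pi/2$, and $$\int_0^1\|\dot\delta(t)\|\,dt\le\int_a^b\|\dot\gamma(t)\|\,dt$$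 for every $a<b$ and every $C^1$ curve $\gamma:[a,b]\to\mathcal P_{\mathcal A}$ with $\gamma(a)=p$ and $\gamma(b)=q$. Here a geodesic is a smooth curve $\delta$ in $\mathcal P_{\mathcal A}$ whose covariant acceleration, the co-diagonal part $\delta\ddot\delta\delta^\perp+\delta^\perp\ddot\delta\delta$ of $\ddot\delta$, vanishes identically. -/

import Mathlib

open Set

namespace VonNeumannAlgebra

variable {H : Type*} [NormedAddCommGroup H] [InnerProductSpace ℂ H] [CompleteSpace H]

/-- A factor: the center consists of the scalar operators. -/
def IsFactor (A : VonNeumannAlgebra H) : Prop :=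
  ∀ z ∈ A, (∀ a ∈ A, a * z = z * a) → ∃ c : ℂ, z = c • (1 : H →L[ℂ] H)

/-- A finite von Neumann algebra: every isometry in `A` is unitary. -/
def IsFiniteAlgebra (A : VonNeumannAlgebra H) : Prop :=
  ∀ v ∈ A, star v * v = 1 → v * star v = 1

/-- A faithful normal (finite, not necessarily normalized) trace on `A`. The order on `A` is the
usual (Loewner) order of operators. -/
structure IsFaithfulNormalTrace (A : VonNeumannAlgebra H)
    (τ : A.toStarSubalgebra →ₗ[ℂ] ℂ) : Prop where
  tracial : ∀ a b, τ (a * b) = τ (b * a)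
  nonneg : ∀ a, 0 ≤ (τ (star a * a)).re ∧ (τ (star a * a)).im = 0
  faithful : ∀ a, τ (star a * a) = 0 → a = 0
  /-- `τ` preserves suprema of bounded increasing families of selfadjoint elements. -/
  normal : ∀ (S : Set A.toStarSubalgebra) (a : A.toStarSubalgebra), S.Nonempty →
    (∀ s ∈ S, IsSelfAdjoint s) → DirectedOn (· ≤ ·) S → IsLUB S a →
    IsLUB ((fun s => (τ s).re) '' S) (τ a).re

/-- The set of (selfadjoint) projections of `A`, with the norm topology of operators. -/
def projections (A : VonNeumannAlgebra H) : Set (H →L[ℂ] H) :=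
  {p | p ∈ A ∧ IsStarProjection p}

/-- Murray–von Neumann equivalence relative to `A`. -/
def MvNEquiv (A : VonNeumannAlgebra H) (p q : H →L[ℂ] H) : Prop :=
  ∃ v ∈ A, star v * v = p ∧ v * star v = q

/-- Unitary equivalence relative to `A`. -/
def UnitaryEquiv (A : VonNeumannAlgebra H) (p q : H →L[ℂ] H) : Prop :=
  ∃ u ∈ A, star u * u = 1 ∧ u * star u = 1 ∧ u * p * star u = q

/-- The infimum `p ∧ q` of two projections, the orthogonal projection onto `R(p) ∩ R(q)`.
(For projections this intersection is closed; the closure makes the definition total.) -/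
noncomputable def projInf (p q : H →L[ℂ] H) : H →L[ℂ] H :=
  haveI : CompleteSpace (p.range ⊓ q.range).topologicalClosure :=
    (Submodule.isClosed_topologicalClosure _).completeSpace_coe
  (p.range ⊓ q.range).topologicalClosure.starProjection

theorem projInf_mem (A : VonNeumannAlgebra H) {p q : H →L[ℂ] H} (hp : p ∈ A) (hq : q ∈ A) :
    projInf p q ∈ A := by
  have : CompleteSpace (p.range ⊓ q.range).topologicalClosure :=
    (Submodule.isClosed_topologicalClosure _).completeSpace_coe
  have hs : IsStarProjection (projInf p q) := isStarProjection_starProjection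
  rw [IsStarProjection.mem_iff hs]
  intro y hy
  have hr : (projInf p q).range = (p.range ⊓ q.range).topologicalClosure :=
    Submodule.range_starProjection _
  rw [hr, Module.End.mem_invtSubmodule]
  have hcomm := mem_commutant_iff.1 hy
  intro x hx
  have hmaps : MapsTo y (p.range ⊓ q.range : Submodule ℂ H) (p.range ⊓ q.range : Submodule ℂ H) := by
    rintro x ⟨⟨a, ha⟩, ⟨b, hb⟩⟩
    refine ⟨⟨y a, ?_⟩, ⟨y b, ?_⟩⟩
    · rw [← ha]; exact DFunLike.congr_fun (hcomm p hp) a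
    · rw [← hb]; exact DFunLike.congr_fun (hcomm q hq) b
  exact hmaps.closure y.continuous hx

theorem one_sub_mem' (A : VonNeumannAlgebra H) {p : H →L[ℂ] H} (hp : p ∈ A) : 1 - p ∈ A :=
  sub_mem (one_mem A) hp

/-- The horizontal space at `p`: anti-Hermitian elements of `A` that are co-diagonal for `p`. -/
def horizontal (A : VonNeumannAlgebra H) (p : H →L[ℂ] H) : Set (H →L[ℂ] H) :=
  {z | z ∈ A ∧ star z = -z ∧ p * z * p = 0 ∧ (1 - p) * z * (1 - p) = 0}

/-- The covariant derivative of a tangent field `X` along a curve `γ` of projections: the tangential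
(that is, co-diagonal with respect to `γ t`) part of the derivative of `X`. -/
noncomputable def covariantDeriv (γ X : ℝ → H →L[ℂ] H) (t : ℝ) : H →L[ℂ] H :=
  γ t * deriv X t * (1 - γ t) + (1 - γ t) * deriv X t * γ t

/-- A geodesic of the manifold of projections of `A`: a smooth curve of projections of `A` whose
velocity field is parallel. -/
structure IsGeodesic (A : VonNeumannAlgebra H) (δ : ℝ → H →L[ℂ] H) : Prop where
  smooth : ContDiff ℝ (⊤ : ℕ∞) δ
  mem : ∀ t, δ t ∈ A.projections
  parallel : ∀ t, covariantDeriv δ (deriv δ) t = 0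

/-- A normalized geodesic: its initial speed is at most `π / 2`. -/
def IsNormalizedGeodesic (A : VonNeumannAlgebra H) (δ : ℝ → H →L[ℂ] H) : Prop :=
  A.IsGeodesic δ ∧ ‖deriv δ 0‖ ≤ Real.pi / 2

/-- The length of a curve on `[a, b]` for the operator norm on the tangent spaces. -/
noncomputable def curveLength (γ : ℝ → H →L[ℂ] H) (a b : ℝ) : ℝ :=
  ∫ t in a..b, ‖derivWithin γ (Icc a b) t‖

/-- `δ` on `[0, 1]` is at most as long as any `C¹` curve of projections of `A` with the same
endpoints. -/
def IsMinimalCurve (A : VonNeumannAlgebra H) (δ : ℝ → H →L[ℂ] H) : Prop :=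
  ∀ (γ : ℝ → H →L[ℂ] H) (a b : ℝ), a < b → ContDiffOn ℝ 1 γ (Icc a b) →
    (∀ t ∈ Icc a b, γ t ∈ A.projections) → γ a = δ 0 → γ b = δ 1 →
    curveLength δ 0 1 ≤ curveLength γ a b

/-- The curve `t ↦ e^{tz} p e^{-tz}`. -/
noncomputable def expCurve (z p : H →L[ℂ] H) (t : ℝ) : H →L[ℂ] H :=
  NormedSpace.exp (t • z) * p * NormedSpace.exp (-(t • z))

end VonNeumannAlgebra

/-! Everything is read off the symmetries `S = 2p - 1` and `T = 2q - 1`. The square of `S + T`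
commutes with `S` and `T`, so off the kernel of `S + T` the sign of `S + T` is a symmetry carrying
`S` to `T`. The kernel is the range of `e + f`, where `e = p ∧ q^⊥` and `f = p^⊥ ∧ q`, and there `S
= -T`. Conjugation by the sign gives `τ p - τ e = τ q - τ f` (`map_sub_projInf`), so `τ p = τ q`
forces `τ e = τ f`. In a factor, orthogonal projections of equal trace are equivalent
(`mvNEquiv_of_trace_eq`), and a partial isometry from `e` to `f` repairs the sign on the kernel.

The result is a symmetry `Q` with `Q S = T Q`, and `U = Q S` is the direct rotation: a unitary of
`A` with `U p U* = q`, `S U S = U*` and `U + U* ≥ 0` (`exists_direct_rotation`). Positivity bounds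
its logarithm `ix` by `π/2`, and `S U S = U*` makes `x` anticommute with `S`, that is, codiagonal.
So `z = ix` generates a geodesic from `p` to `q` of length `‖x‖`.

Minimality is spherical geometry. For a unit vector `ξ`, a curve `γ` of projections moves `(2γ -
1)ξ` on the unit sphere at speed at most `2‖γ'‖`. If its length `L` is below `π/2`, then `‖T - S‖² ≤
2(1 - cos 2L)`. But `T S = U² = e^{2ix}`, so `‖T - S‖² = 2(1 - cos 2‖x‖)`, which excludes `L < ‖x‖`.

Finally, projections at distance less than `1` are similar in `A`, so the trace is constant on
connected components; conversely, the geodesic is a connected set joining `p` to `q`. -/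

namespace VonNeumannAlgebra

variable {H : Type*} [NormedAddCommGroup H] [InnerProductSpace ℂ H] [CompleteSpace H]

/-! ### Absolute values, kernel projections and signs inside `A` -/

theorem mem_of_commute_commutant (A : VonNeumannAlgebra H) {x : H →L[ℂ] H}
    (h : ∀ y ∈ A.commutant, Commute y x) : x ∈ A := by
  rw [← A.commutant_commutant, mem_commutant_iff]
  exact fun y hy => h y hy

theorem commute_of_mem_commutant {A : VonNeumannAlgebra H} {x y : H →L[ℂ] H}
    (hy : y ∈ A.commutant) (hx : x ∈ A) : Commute y x :=
  (mem_commutant_iff.1 hy x hx).symm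

theorem mul_eq_zero_of_mul_mul_eq_zero {C X : H →L[ℂ] H} (hC : IsSelfAdjoint C)
    (h : C * C * X = 0) : C * X = 0 := by
  rw [← CStarRing.star_mul_self_eq_zero_iff, star_mul, hC.star_eq]
  rw [mul_assoc] at h
  rw [mul_assoc, h, mul_zero]

/-- The commutation clause asks only that `y` commute with `B * B`, so it also covers symmetries
that anticommute with `B`. -/
theorem exists_absolute_value {B : H →L[ℂ] H} (hB : IsSelfAdjoint B) :
    ∃ C : H →L[ℂ] H, 0 ≤ C ∧ C * C = B * B ∧ ∀ y, Commute (B * B) y → Commute C y :=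
  ⟨CFC.sqrt (B * B), CFC.sqrt_nonneg _, CFC.sqrt_mul_sqrt_self _ hB.mul_self_nonneg,
    fun _ h => h.cfcₙ_nnreal _⟩

omit [CompleteSpace H] in
theorem mul_starProjection_eq_zero {D : H →L[ℂ] H} {K : Submodule ℂ H} [K.HasOrthogonalProjection]
    (h : K ≤ D.ker) : D * K.starProjection = 0 := by
  ext ξ
  exact h (K.starProjection_apply_mem ξ)

/-- The orthogonal projection onto the kernel of an element of `A` belongs to `A`. -/
theorem exists_ker_projection (A : VonNeumannAlgebra H) {D : H →L[ℂ] H} (hD : D ∈ A) :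
    ∃ G ∈ A.projections, D * G = 0 ∧ ∀ X, D * X = 0 → G * X = X := by
  have : CompleteSpace D.ker := D.isClosed_ker.completeSpace_coe
  have hs : IsStarProjection (D.ker.starProjection) := isStarProjection_starProjection
  refine ⟨D.ker.starProjection, ⟨?_, hs⟩, mul_starProjection_eq_zero le_rfl, ?_⟩
  · rw [IsStarProjection.mem_iff hs]
    intro y hy x hx
    rw [Submodule.range_starProjection] at hx ⊢
    have h := DFunLike.congr_fun (commute_of_mem_commutant hy hD).eq x
    change D x = 0 at hx
    change D (y x) = 0
    change y (D x) = D (y x) at h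
    rw [← h, hx, map_zero]
  · intro X hX
    ext ξ
    exact Submodule.starProjection_eq_self_iff.2 (DFunLike.congr_fun hX ξ)

/-- The absolute value `C` and a symmetry `R` in `A` with `R * C = B`. -/
theorem exists_symmetry_mul_abs (A : VonNeumannAlgebra H) {B : H →L[ℂ] H} (hB : B ∈ A)
    (hs : IsSelfAdjoint B) :
    ∃ C R : H →L[ℂ] H, 0 ≤ C ∧ C * C = B * B ∧ (∀ y, Commute (B * B) y → Commute C y) ∧
      R ∈ A ∧ IsSelfAdjoint R ∧ R * R = 1 ∧ R * C = B ∧ ∀ X, B * X = 0 → R * X = X := by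
  obtain ⟨C, hC0, hCC, hCB⟩ := exists_absolute_value hs
  have hCs : IsSelfAdjoint C := hC0.isSelfAdjoint
  have hCA : C ∈ A := A.mem_of_commute_commutant fun y hy =>
    (hCB y (commute_of_mem_commutant hy (mul_mem hB hB)).symm).symm
  have hcb : C * B = B * C := (hCB B ((Commute.refl B).mul_left (Commute.refl B))).eq
  -- Since `(C - B) * (C + B) = 0`, the kernel projection `G` of `C - B` fixes `C + B` and kills `C
  -- - B`. Hence `R = 2G - 1` satisfies `2RC = (C + B) - (C - B) = 2B`: it is the sign of `B`, with
  -- value `1` on the kernel of `B`.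
  obtain ⟨G, ⟨hGA, hGp⟩, hG0, hG⟩ := A.exists_ker_projection (sub_mem hCA hB)
  have h1 : G * (C + B) = C + B := hG _ (by
    rw [sub_mul, mul_add, mul_add, hCC, hcb]; abel)
  have h2 : G * (C - B) = 0 := by
    have := congrArg star hG0
    rwa [star_mul, star_zero, star_sub, hGp.isSelfAdjoint.star_eq, hCs.star_eq, hs.star_eq] at this
  have hGG : G * G = G := hGp.isIdempotentElem
  refine ⟨C, G + G - 1, hC0, hCC, hCB, sub_mem (add_mem hGA hGA) (one_mem A), ?_, ?_, ?_, ?_⟩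
  · exact (hGp.isSelfAdjoint.add hGp.isSelfAdjoint).sub (.one _)
  · simp only [mul_sub, sub_mul, mul_add, add_mul, hGG, mul_one, one_mul]; abel
  · rw [mul_sub, sub_eq_zero] at h2
    rw [mul_add, h2] at h1
    rw [sub_mul, add_mul, h2, h1, one_mul]; abel
  · intro X hX
    have hCX : C * X = 0 := mul_eq_zero_of_mul_mul_eq_zero hCs (by rw [hCC, mul_assoc, hX, mul_zero])
    have := hG X (by rw [sub_mul, hCX, hX, sub_zero])
    rw [sub_mul, add_mul, this, one_mul]; abel

/-! ### Infima of projections, and partial isometries -/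

theorem projInf_projections (A : VonNeumannAlgebra H) {p q : H →L[ℂ] H}
    (hp : p ∈ A) (hq : q ∈ A) : projInf p q ∈ A.projections :=
  ⟨A.projInf_mem hp hq, by unfold projInf; exact isStarProjection_starProjection⟩

theorem mul_projInf_left {p q : H →L[ℂ] H} (hp : IsStarProjection p) :
    p * projInf p q = projInf p q := by
  have hpp : p * p = p := hp.isIdempotentElem
  have : CompleteSpace (p.range ⊓ q.range).topologicalClosure :=
    (Submodule.isClosed_topologicalClosure _).completeSpace_coe
  have h : (1 - p) * projInf p q = 0 := by
    refine mul_starProjection_eq_zero (Submodule.topologicalClosure_minimal _ ?_ (1 - p).isClosed_ker)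
    rintro _ ⟨⟨a, rfl⟩, -⟩
    change p a - p (p a) = 0
    rw [sub_eq_zero]
    exact (DFunLike.congr_fun hpp a).symm
  rw [sub_mul, one_mul, sub_eq_zero] at h
  exact h.symm

theorem projInf_comm (p q : H →L[ℂ] H) : projInf p q = projInf q p := by
  unfold projInf
  simp only [inf_comm]

theorem projInf_mul_eq {p q X : H →L[ℂ] H} (hp : p * X = X) (hq : q * X = X) :
    projInf p q * X = X := by
  have : CompleteSpace (p.range ⊓ q.range).topologicalClosure :=
    (Submodule.isClosed_topologicalClosure _).completeSpace_coe
  ext ξ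
  exact Submodule.starProjection_eq_self_iff.2 (Submodule.le_topologicalClosure _
    ⟨⟨X ξ, DFunLike.congr_fun hp ξ⟩, ⟨X ξ, DFunLike.congr_fun hq ξ⟩⟩)

theorem mul_eq_self_of_star_mul_self {v e : H →L[ℂ] H} (he : IsStarProjection e)
    (h : star v * v = e) : v * e = v := by
  have hee : e * e = e := he.isIdempotentElem
  rw [← sub_eq_zero, ← CStarRing.star_mul_self_eq_zero_iff, star_sub, star_mul,
    he.isSelfAdjoint.star_eq]
  calc (e * star v - star v) * (v * e - v)
      = e * (star v * v) * e - e * (star v * v) - star v * v * e + star v * v := by noncomm_ring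
    _ = 0 := by rw [h, hee, hee]; abel

theorem mul_eq_self_of_self_mul_star {v f : H →L[ℂ] H} (hf : IsStarProjection f)
    (h : v * star v = f) : f * v = v := by
  have := mul_eq_self_of_star_mul_self (v := star v) hf (by rwa [star_star])
  simpa [hf.isSelfAdjoint.star_eq] using congrArg star this

/-! ### The symmetries `2 * p - 1` and their intertwining -/

theorem isSelfAdjoint_two_mul_sub_one {p : H →L[ℂ] H} (hp : IsStarProjection p) :
    IsSelfAdjoint (2 * p - 1) := by
  rw [two_mul]
  exact (hp.isSelfAdjoint.add hp.isSelfAdjoint).sub (.one _)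

theorem two_mul_sub_one_mem {A : VonNeumannAlgebra H} {r : H →L[ℂ] H} (hr : r ∈ A) :
    2 * r - 1 ∈ A := by
  rw [two_mul]; exact sub_mem (add_mem hr hr) (one_mem A)

theorem two_mul_sub_one_mul_self {p : H →L[ℂ] H} (hp : IsStarProjection p) :
    (2 * p - 1) * (2 * p - 1) = 1 := by
  have : p * p = p := hp.isIdempotentElem
  calc (2 * p - 1) * (2 * p - 1) = 4 * (p * p) - 4 * p + 1 := by noncomm_ring
    _ = 1 := by rw [this]; abel

/-- Let `S` and `T` be symmetries, `F` the kernel projection of `S + T`, and `W` a selfadjoint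
symmetry of the range of `F` which anticommutes there with `S = -T`. Then there is a symmetry `Q`
with `Q * S = T * Q` and `Q * S + S * Q ≥ 0`. -/
theorem exists_intertwining_symmetry (A : VonNeumannAlgebra H) {S T F W : H →L[ℂ] H}
    (hSA : S ∈ A) (hTA : T ∈ A) (hFA : F ∈ A) (hWA : W ∈ A)
    (hS : IsSelfAdjoint S) (hT : IsSelfAdjoint T) (hF : IsSelfAdjoint F) (hW : IsSelfAdjoint W)
    (hSS : S * S = 1) (hTT : T * T = 1) (hFF : F * F = F) (hSTF : (S + T) * F = 0)
    (hFX : ∀ X, (S + T) * X = 0 → F * X = X) (hFW : F * W = W) (hWW : W * W = F)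
    (hWS : W * S = T * W) (hWS' : W * S + S * W = 0) :
    ∃ Q ∈ A, IsSelfAdjoint Q ∧ Q * Q = 1 ∧ Q * S = T * Q ∧ 0 ≤ Q * S + S * Q := by
  obtain ⟨C, R, hC0, hCC, hCB, hRA, hR, hRR, hRC, hRX⟩ :=
    A.exists_symmetry_mul_abs (add_mem hSA hTA) (hS.add hT)
  have hC : IsSelfAdjoint C := hC0.isSelfAdjoint
  have hBB : (S + T) * (S + T) = 2 + S * T + T * S := by
    calc (S + T) * (S + T) = S * S + T * T + S * T + T * S := by noncomm_ring
      _ = _ := by rw [hSS, hTT, one_add_one_eq_two]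
  have hCS : C * S = S * C := (hCB S (by
    rw [commute_iff_eq, hBB]
    calc (2 + S * T + T * S) * S = 2 * S + S * T * S + T * (S * S) := by noncomm_ring
      _ = 2 * S + S * T * S + (S * S) * T := by rw [hSS]; noncomm_ring
      _ = _ := by noncomm_ring)).eq
  have hRF : R * F = F := hRX F hSTF
  have hFR : F * R = F := by simpa [hF.star_eq, hR.star_eq] using congrArg star hRF
  have hWF : W * F = W := by simpa [hF.star_eq, hW.star_eq] using congrArg star hFW
  have hRW : R * W = W := by rw [← hFW, ← mul_assoc, hRF]
  have hWR : W * R = W := by rw [← hWF, mul_assoc, hFR]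
  have hCF : C * F = 0 := mul_eq_zero_of_mul_mul_eq_zero hC (by
    rw [hCC, mul_assoc, hSTF, mul_zero])
  have hFB : F * (S + T) = 0 := by
    simpa [hF.star_eq, hS.star_eq, hT.star_eq] using congrArg star hSTF
  -- `(S + T) * S = T * (S + T)`, so `S` preserves the kernel of `S + T`; being selfadjoint, it
  -- commutes with `F`.
  have hSF : S * F = F * S := by
    have h : F * (S * F) = S * F := hFX _ (by
      calc (S + T) * (S * F) = T * ((S + T) * F) + (S * S) * F - (T * T) * F := by noncomm_ring
        _ = 0 := by rw [hSTF, hSS, hTT]; noncomm_ring)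
    rw [← h]
    have := congrArg star h
    simp only [star_mul, hF.star_eq, hS.star_eq] at this
    rw [← mul_assoc, this]
  -- An operator killing the range of `C` is supported on `F`. An identity may therefore be tested
  -- on the range of `C` and on `F` separately.
  have hkey : ∀ D : H →L[ℂ] H, D * C = 0 → D * F = D := by
    intro D hD
    have hD' : C * star D = 0 := by simpa [hC.star_eq] using congrArg star hD
    have : F * star D = star D := hFX _ (by rw [← hRC, mul_assoc, hD', mul_zero])
    simpa [hF.star_eq] using congrArg star this
  have hD := hkey (R * S - T * R) (by
    calc (R * S - T * R) * C = R * (S * C) - T * (R * C) := by noncomm_ring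
      _ = (R * C) * S - T * (R * C) := by rw [← hCS]; noncomm_ring
      _ = 0 := by rw [hRC]; rw [add_mul, mul_add, hSS, hTT]; abel)
  have hE := hkey ((R - F) * S + S * (R - F) - C) (by
    calc ((R - F) * S + S * (R - F) - C) * C
        = R * (S * C) - F * (S * C) + S * (R * C) - S * F * C - C * C := by noncomm_ring
      _ = (R * C) * S - F * S * C + S * (R * C) - S * F * C - C * C := by
        rw [← hCS]; simp only [mul_assoc, hCS]
      _ = (S + T) * S + S * (S + T) - (S + T) * (S + T) := by
        have hFC : F * C = 0 := by simpa [hF.star_eq, hC.star_eq] using congrArg star hCF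
        rw [hRC, hCC, ← hSF, mul_assoc S F C, hFC, mul_zero]; abel
      _ = S * S - T * T := by noncomm_ring
      _ = 0 := by rw [hSS, hTT, sub_self])
  have hsum : (R - F + W) * S + S * (R - F + W) = C := by
    have h0 : ((R - F) * S + S * (R - F) - C) * F = 0 := by
      calc ((R - F) * S + S * (R - F) - C) * F
          = R * (S * F) - F * (S * F) + S * (R * F) - S * (F * F) - C * F := by noncomm_ring
        _ = 0 := by
          rw [hSF, hRF, hCF, hFF, ← mul_assoc, hRF, ← mul_assoc, hFF]; abel
    rw [h0] at hE
    calc (R - F + W) * S + S * (R - F + W)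
        = ((R - F) * S + S * (R - F) - C) + C + (W * S + S * W) := by noncomm_ring
      _ = C := by rw [← hE, hWS']; abel
  -- On the range of `F` the sign `R` is the identity and does not carry `S` to `T = -S`; there it
  -- is replaced by `W`.
  refine ⟨R - F + W, add_mem (sub_mem hRA hFA) hWA, (hR.sub hF).add hW, ?_, ?_, hsum ▸ hC0⟩
  · calc (R - F + W) * (R - F + W)
        = R * R - R * F - F * R + F * F + R * W + W * R - F * W - W * F + W * W := by noncomm_ring
      _ = 1 := by rw [hRR, hRF, hFR, hFF, hRW, hWR, hFW, hWF, hWW]; abel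
  · have h1 : (R - F) * S = T * (R - F) := by
      have : (R * S - T * R) * F = F * S - T * F := by
        rw [sub_mul, mul_assoc, hSF, ← mul_assoc, hRF, mul_assoc, hRF]
      rw [hD] at this
      rw [sub_mul, mul_sub, ← sub_eq_zero]
      calc R * S - F * S - (T * R - T * F) = (R * S - T * R) - (F * S - T * F) := by abel
        _ = 0 := by rw [this, sub_self]
    rw [add_mul, mul_add, h1, hWS]

/-- The kernel of `(2 * p - 1) + (2 * q - 1)` is the sum of the ranges of `p ∧ (1 - q)` and
`(1 - p) ∧ q`. -/
theorem projInf_add_projInf_mul_eq {p q X : H →L[ℂ] H} (hp : IsStarProjection p)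
    (hq : IsStarProjection q) (hX : (2 * p - 1 + (2 * q - 1)) * X = 0) :
    (projInf p (1 - q) + projInf (1 - p) q) * X = X := by
  have hpp : p * p = p := hp.isIdempotentElem
  have hqq : q * q = q := hq.isIdempotentElem
  -- Applying `p` and `q` to this equation gives `pqX = 0` and `qpX = 0`, so `X = pX + qX` splits
  -- into the two infima.
  have h1 : p * X + q * X = X := by
    have h2 : (2 : ℂ) • (p * X + q * X - X) = 0 := by
      rw [← hX, two_smul]; noncomm_ring
    exact sub_eq_zero.1 ((smul_eq_zero.1 h2).resolve_left two_ne_zero)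
  have hpq : p * (q * X) = 0 := by
    have := congrArg (p * ·) h1
    simpa [mul_add, ← mul_assoc, hpp] using this
  have hqp : q * (p * X) = 0 := by
    have := congrArg (q * ·) h1
    simpa [mul_add, ← mul_assoc, hqq] using this
  have h3 : projInf p (1 - q) * (p * X) = p * X :=
    projInf_mul_eq (by rw [← mul_assoc, hpp]) (by rw [sub_mul, one_mul, hqp, sub_zero])
  have h4 : projInf (1 - p) q * (q * X) = q * X :=
    projInf_mul_eq (by rw [sub_mul, one_mul, hpq, sub_zero]) (by rw [← mul_assoc, hqq])
  have h5 : projInf p (1 - q) * p = projInf p (1 - q) := by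
    have := congrArg star (mul_projInf_left (q := 1 - q) hp)
    unfold projInf at this ⊢
    simpa [hp.isSelfAdjoint.star_eq, isSelfAdjoint_starProjection _ |>.star_eq] using this
  have h6 : projInf (1 - p) q * q = projInf (1 - p) q := by
    have := congrArg star (mul_projInf_left (q := 1 - p) hq)
    rw [projInf_comm] at this
    unfold projInf at this ⊢
    simpa [hq.isSelfAdjoint.star_eq, isSelfAdjoint_starProjection _ |>.star_eq] using this
  rw [← mul_assoc, h5] at h3
  rw [← mul_assoc, h6] at h4
  rw [add_mul, h3, h4, h1]

/-! ### Trace identities for two projections -/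

namespace IsFaithfulNormalTrace

variable {A : VonNeumannAlgebra H} {τ : A.toStarSubalgebra →ₗ[ℂ] ℂ}

theorem map_eq_of_mul_comm (hτ : A.IsFaithfulNormalTrace τ) {a b x y : H →L[ℂ] H} (ha : a ∈ A)
    (hb : b ∈ A) (hx : x ∈ A) (hy : y ∈ A) (h₁ : a * b = x) (h₂ : b * a = y) :
    τ ⟨x, hx⟩ = τ ⟨y, hy⟩ := by
  subst h₁ h₂
  exact hτ.tracial ⟨a, ha⟩ ⟨b, hb⟩

theorem map_sub_eq (_ : A.IsFaithfulNormalTrace τ) {x y z : H →L[ℂ] H} (hx : x ∈ A)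
    (hy : y ∈ A) (hz : z ∈ A) (h : x - y = z) : τ ⟨z, hz⟩ = τ ⟨x, hx⟩ - τ ⟨y, hy⟩ := by
  subst h
  exact map_sub τ ⟨x, hx⟩ ⟨y, hy⟩

theorem eq_zero_of_map_eq_zero (hτ : A.IsFaithfulNormalTrace τ) {f : H →L[ℂ] H} (hf : f ∈ A)
    (hfp : IsStarProjection f) (h : τ ⟨f, hf⟩ = 0) : f = 0 := by
  have := hτ.faithful ⟨f, hf⟩ (by
    rw [← h]
    congr 1
    apply Subtype.ext
    change star f * f = f
    rw [hfp.isSelfAdjoint.star_eq]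
    exact hfp.isIdempotentElem)
  exact congrArg Subtype.val this

/-- `τ p - τ (p ∧ (1 - q)) = τ q - τ ((1 - p) ∧ q)`. -/
theorem map_sub_projInf (hτ : A.IsFaithfulNormalTrace τ) {p q : H →L[ℂ] H}
    (hp : p ∈ A.projections) (hq : q ∈ A.projections) :
    τ ⟨p, hp.1⟩ - τ ⟨projInf p (1 - q), A.projInf_mem hp.1 (A.one_sub_mem' hq.1)⟩ =
      τ ⟨q, hq.1⟩ - τ ⟨projInf (1 - p) q, A.projInf_mem (A.one_sub_mem' hp.1) hq.1⟩ := by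
  have heA := A.projInf_projections hp.1 (A.one_sub_mem' hq.1)
  have hfA := A.projInf_projections (A.one_sub_mem' hp.1) hq.1
  have hpe := mul_projInf_left (q := 1 - q) hp.2
  have hqe := mul_projInf_left (q := p) hq.2.one_sub
  have hpf := mul_projInf_left (q := q) hp.2.one_sub
  have hqf := mul_projInf_left (q := 1 - p) hq.2
  have hker := fun X => projInf_add_projInf_mul_eq (X := X) hp.2 hq.2
  rw [projInf_comm] at hqe hqf
  change _ - τ ⟨_, heA.1⟩ = _ - τ ⟨_, hfA.1⟩
  generalize projInf p (1 - q) = e at *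
  generalize projInf (1 - p) q = f at *
  rw [sub_mul, one_mul, sub_eq_self] at hqe hpf
  have hsp := isSelfAdjoint_two_mul_sub_one hp.2
  have hsq := isSelfAdjoint_two_mul_sub_one hq.2
  obtain ⟨C, R, hC0, hCC, hCB, hRA, hR, hRR, hRC, hRX⟩ :=
    A.exists_symmetry_mul_abs (add_mem (two_mul_sub_one_mem hp.1) (two_mul_sub_one_mem hq.1)) (hsp.add hsq)
  have hpp : p * p = p := hp.2.isIdempotentElem
  have hqq : q * q = q := hq.2.isIdempotentElem
  have hC : IsSelfAdjoint C := hC0.isSelfAdjoint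
  have hCp : C * p = p * C := (hCB p (by
    rw [commute_iff_eq]
    calc (2 * p - 1 + (2 * q - 1)) * (2 * p - 1 + (2 * q - 1)) * p
        = 4 * (p * p) * p - 8 * (p * p) + 4 * p + 4 * (p * q * p) + 4 * (q * (p * p))
          - 8 * (q * p) + 4 * (q * q) * p := by noncomm_ring
      _ = 4 * p * (p * p) - 8 * (p * p) + 4 * p + 4 * (p * q * p) + 4 * ((p * p) * q)
          - 8 * (p * q) + 4 * (p * (q * q)) := by rw [hpp, hqq]; noncomm_ring
      _ = _ := by noncomm_ring)).eq
  have hF : IsSelfAdjoint (e + f) := heA.2.isSelfAdjoint.add hfA.2.isSelfAdjoint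
  have hBF : (2 * p - 1 + (2 * q - 1)) * (e + f) = 0 := by
    calc (2 * p - 1 + (2 * q - 1)) * (e + f)
        = 2 * (p * e) + 2 * (q * e) + 2 * (p * f) + 2 * (q * f) - 2 * e - 2 * f := by noncomm_ring
      _ = 0 := by rw [hpe, hqe, hpf, hqf]; simp
  have hRF := hRX _ hBF
  have hD0 : (R * p - q * R) * C = 0 := by
    calc (R * p - q * R) * C = R * (p * C) - q * (R * C) := by noncomm_ring
      _ = (R * C) * p - q * (R * C) := by rw [← hCp]; noncomm_ring
      _ = 2 * (p * p - p) + 2 * (q - q * q) := by rw [hRC]; noncomm_ring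
      _ = 0 := by rw [hpp, hqq]; simp
  have hD : (R * p - q * R) * (e + f) = R * p - q * R := by
    have hD' : C * star (R * p - q * R) = 0 := by
      rw [← hC.star_eq, ← star_mul, hD0, star_zero]
    have := hker (star (R * p - q * R)) (by rw [← hRC, mul_assoc, hD', mul_zero])
    simpa only [star_mul, star_star, hF.star_eq] using congrArg star this
  -- The defect `R * p - q * R` is supported on `e + f`, where `R` is the identity and the defect
  -- equals `R * e - f`. With `f * R = f` this yields `R * (p - e) * R = q - f`. No equivalence of
  -- `e` and `f` is needed.
  have hD2 : R * p - R * e = q * R - f := by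
    have h1 : (R * p - q * R) * (e + f) = R * e - f := by
      rw [sub_mul, mul_assoc, mul_assoc, hRF, mul_add, hpe, hpf, mul_add q, hqe, hqf, add_zero,
        zero_add]
    rw [h1] at hD
    rw [sub_eq_sub_iff_sub_eq_sub, ← hD]
  have hfR : f * R = f := by
    have h := hRX f (by
      have h2 : (e + f) * f = f := by
        have hef : e * f = 0 := by
          have := congrArg star hpe
          rw [star_mul, hp.2.isSelfAdjoint.star_eq, heA.2.isSelfAdjoint.star_eq] at this
          rw [← this, mul_assoc, hpf, mul_zero]
        rw [add_mul, hef, zero_add]; exact hfA.2.isIdempotentElem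
      rw [← h2, ← mul_assoc, hBF, zero_mul])
    simpa [hR.star_eq, hfA.2.isSelfAdjoint.star_eq] using congrArg star h
  rw [← hτ.map_sub_eq hp.1 heA.1 (sub_mem hp.1 heA.1) rfl,
    ← hτ.map_sub_eq hq.1 hfA.1 (sub_mem hq.1 hfA.1) rfl]
  refine hτ.map_eq_of_mul_comm hRA (mul_mem hRA (sub_mem hp.1 heA.1)) _ _ ?_ ?_
  · rw [← mul_assoc, hRR, one_mul]
  · rw [mul_sub, hD2, sub_mul, mul_assoc, hRR, mul_one, hfR]

end IsFaithfulNormalTrace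

/-! ### Comparison in a factor: orthogonal projections of equal trace -/

/-- In a factor, nonzero projections are not centrally orthogonal. -/
theorem IsFactor.exists_mul_mul_ne_zero {A : VonNeumannAlgebra H} (hA : A.IsFactor)
    {e f : H →L[ℂ] H} (hf : f ∈ A) (he0 : e ≠ 0) (hf0 : f ≠ 0) :
    ∃ a ∈ A, f * a * e ≠ 0 := by
  by_contra! hcon
  -- The common kernel of all `f * a` is closed and invariant under `A` and its commutant, so its
  -- projection is central, hence scalar. It fixes `e` and is killed by `f`: the scalar would have
  -- to be both `1` and `0`.
  let J : Submodule ℂ H :=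
    { carrier := {ξ | ∀ a ∈ A, f (a ξ) = 0}
      add_mem' := fun {x y} hx hy a ha => by rw [map_add, map_add, hx a ha, hy a ha, add_zero]
      zero_mem' := fun a _ => by rw [map_zero, map_zero]
      smul_mem' := fun c x hx a ha => by rw [map_smul, map_smul, hx a ha, smul_zero] }
  have hJ : IsClosed (J : Set H) := by
    have : (J : Set H) = ⋂ a ∈ A, {ξ | f (a ξ) = 0} := by ext; simp [J]
    rw [this]
    exact isClosed_biInter fun a _ => isClosed_eq (by fun_prop) continuous_const
  have : CompleteSpace J := hJ.completeSpace_coe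
  have hs : IsStarProjection J.starProjection := isStarProjection_starProjection
  have hZA : J.starProjection ∈ A := by
    rw [IsStarProjection.mem_iff hs]
    intro y hy x hx
    rw [Submodule.range_starProjection] at hx ⊢
    intro a ha
    have h1 := DFunLike.congr_fun (commute_of_mem_commutant hy ha).eq x
    have h2 := DFunLike.congr_fun (commute_of_mem_commutant hy hf).eq (a x)
    change y (a x) = a (y x) at h1
    change y (f (a x)) = f (y (a x)) at h2
    change f (a (y x)) = 0
    rw [← h1, ← h2, hx a ha, map_zero]
  have hZA' : J.starProjection ∈ A.commutant := by
    rw [IsStarProjection.mem_iff hs, commutant_commutant]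
    intro y hy x hx
    rw [Submodule.range_starProjection] at hx ⊢
    exact fun a ha => hx (a * y) (mul_mem ha hy)
  obtain ⟨c, hc⟩ := hA _ hZA fun a ha => mem_commutant_iff.1 hZA' a ha
  have hZe : J.starProjection * e = e := by
    ext ξ
    exact Submodule.starProjection_eq_self_iff.2 fun a ha => DFunLike.congr_fun (hcon a ha) ξ
  have hfZ : f * J.starProjection = 0 :=
    mul_starProjection_eq_zero fun ξ hξ => by simpa using hξ 1 (one_mem A)
  rw [hc] at hZe hfZ
  rw [mul_smul_comm, mul_one, smul_eq_zero] at hfZ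
  rw [smul_mul_assoc, one_mul] at hZe
  have hc0 := hfZ.resolve_right hf0
  exact he0 (by rw [← hZe, hc0, zero_smul])

/-- A subspace of the range of `e + f`, invariant under the commutant of `A`, on which the form
`⟪x, (e - f) y⟫` vanishes: the graph of a partial isometry of `A` from the range of `e` to the range
of `f`. -/
structure IsIsotropic (A : VonNeumannAlgebra H) (e f : H →L[ℂ] H) (K : Submodule ℂ H) : Prop where
  add_apply : ∀ x ∈ K, (e + f) x = x
  apply_mem : ∀ y ∈ A.commutant, ∀ x ∈ K, y x ∈ K
  inner_eq_zero : ∀ x ∈ K, ∀ y ∈ K, inner ℂ x ((e - f) y) = 0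

theorem exists_maximal_isIsotropic (A : VonNeumannAlgebra H) (e f : H →L[ℂ] H) :
    ∃ K, Maximal (A.IsIsotropic e f) K := by
  refine zorn_le₀ {K | A.IsIsotropic e f K} fun c hc hchain => ?_
  rcases c.eq_empty_or_nonempty with rfl | hne
  · refine ⟨⊥, ⟨?_, ?_, ?_⟩, by simp⟩ <;> simp +contextual
  refine ⟨sSup c, ⟨?_, ?_, ?_⟩, fun z hz => le_sSup hz⟩
  · intro x hx
    obtain ⟨K, hK, hxK⟩ := (Submodule.mem_sSup_of_directed hne hchain.directedOn).1 hx
    exact (hc hK).add_apply x hxK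
  · intro y hy x hx
    obtain ⟨K, hK, hxK⟩ := (Submodule.mem_sSup_of_directed hne hchain.directedOn).1 hx
    exact le_sSup hK ((hc hK).apply_mem y hy x hxK)
  · intro x hx y hy
    obtain ⟨K, hK, hxK⟩ := (Submodule.mem_sSup_of_directed hne hchain.directedOn).1 hx
    obtain ⟨L, hL, hyL⟩ := (Submodule.mem_sSup_of_directed hne hchain.directedOn).1 hy
    rcases hchain.total hK hL with h | h
    · exact (hc hL).inner_eq_zero x (h hxK) y hyL
    · exact (hc hK).inner_eq_zero x hxK y (h hyL)

/-- The conditions pass to the closure of `K`. Isotropy becomes `P * (e - f) * P = 0`, so `P e P = P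
f P = P / 2`, which is how the graph of a partial isometry sits over its two sides. -/
theorem IsIsotropic.exists_projection {A : VonNeumannAlgebra H} {e f : H →L[ℂ] H}
    {K : Submodule ℂ H} (hK : A.IsIsotropic e f K) :
    ∃ P ∈ A.projections, (e + f) * P = P ∧ P * (e - f) * P = 0 ∧ ∀ x ∈ K, P x = x := by
  have : CompleteSpace K.topologicalClosure :=
    (Submodule.isClosed_topologicalClosure _).completeSpace_coe
  have hs : IsStarProjection K.topologicalClosure.starProjection := isStarProjection_starProjection
  refine ⟨_, ⟨?_, hs⟩, ?_, ?_, fun x hx =>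
    Submodule.starProjection_eq_self_iff.2 (K.le_topologicalClosure hx)⟩
  · rw [IsStarProjection.mem_iff hs]
    intro y hy x hx
    rw [Submodule.range_starProjection] at hx ⊢
    have hm : MapsTo y (K : Set H) (K : Set H) := hK.apply_mem y hy
    exact hm.closure y.continuous hx
  · have : (1 - (e + f)) * K.topologicalClosure.starProjection = 0 :=
      mul_starProjection_eq_zero (K.topologicalClosure_minimal (fun x hx => by
        change x - (e + f) x = 0
        rw [hK.add_apply x hx, sub_self]) (1 - (e + f)).isClosed_ker)
    rw [sub_mul, one_mul, sub_eq_zero] at this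
    exact this.symm
  · refine mul_starProjection_eq_zero (K.topologicalClosure_minimal (fun x hx => ?_)
      (K.topologicalClosure.starProjection * (e - f)).isClosed_ker)
    change K.topologicalClosure.starProjection ((e - f) x) = 0
    rw [Submodule.starProjection_apply_eq_zero_iff, Submodule.orthogonal_closure]
    exact fun y hy => hK.inner_eq_zero y hy x hx

/-- A nonzero `f₂ * a * e₂` yields a nonzero element of `A` whose range is isotropic for `(e, f)`
and lies in the range of `e₂ + f₂`. -/
theorem exists_isotropic_range {A : VonNeumannAlgebra H} {e f e₂ f₂ x : H →L[ℂ] H}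
    (he : IsStarProjection e) (hf : IsStarProjection f) (hef : e * f = 0)
    (hxA : x ∈ A) (hx0 : x ≠ 0) (hee : e * e₂ = e₂) (hff : f * f₂ = f₂)
    (hex : x * e₂ = x) (hfx : f₂ * x = x) (he₂ : IsSelfAdjoint e₂)
    (hf₂ : IsSelfAdjoint f₂) :
    ∃ D ∈ A, D ≠ 0 ∧ (e₂ + f₂) * D = D ∧ star D * (e - f) * D = 0 := by
  have hfe : f * e = 0 := by
    simpa [he.isSelfAdjoint.star_eq, hf.isSelfAdjoint.star_eq] using congrArg star hef
  have hef₂ : e * f₂ = 0 := by rw [← hff, ← mul_assoc, hef, zero_mul]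
  have hfe₂ : f * e₂ = 0 := by rw [← hee, ← mul_assoc, hfe, zero_mul]
  have hexs : e₂ * star x = star x := by simpa [he₂.star_eq] using congrArg star hex
  have hfx0 : f * x = x := by rw [← hfx, ← mul_assoc, hff]
  have hexs0 : e * star x = star x := by rw [← hexs, ← mul_assoc, hee]
  have hfxs0 : f * star x = 0 := by rw [← hexs, ← mul_assoc, hfe₂, zero_mul]
  have hxf0 : x * f = 0 := by simpa [hf.isSelfAdjoint.star_eq] using congrArg star hfxs0
  have hBs : IsSelfAdjoint (x + star x) := IsSelfAdjoint.add_star_self x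
  obtain ⟨C, hC0, hCC, hCB⟩ := exists_absolute_value hBs
  have hBA : x + star x ∈ A := add_mem hxA (star_mem hxA)
  have hC : IsSelfAdjoint C := hC0.isSelfAdjoint
  have hCA : C ∈ A := A.mem_of_commute_commutant fun y hy =>
    (hCB y (commute_of_mem_commutant hy (mul_mem hBA hBA)).symm).symm
  -- `1 - 2f` agrees with `e - f` on the range of `e₂ + f₂`. It anticommutes with the off-diagonal
  -- `x + x*`, hence commutes with the absolute value `C`.
  have hSB : (1 - 2 * f) * (x + star x) = - ((x + star x) * (1 - 2 * f)) := by
    have hsf : star x * f = star x := by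
      simpa [hf.isSelfAdjoint.star_eq] using congrArg star hfx0
    calc (1 - 2 * f) * (x + star x) = x + star x - 2 * (f * x) - 2 * (f * star x) := by
          noncomm_ring
      _ = - (x + star x - 2 * (x * f) - 2 * (star x * f)) := by
          rw [hfx0, hfxs0, hxf0, hsf]; noncomm_ring
      _ = _ := by noncomm_ring
  have hCS : C * (1 - 2 * f) = (1 - 2 * f) * C := (hCB _ (by
    rw [commute_iff_eq, ← mul_assoc (1 - 2 * f), hSB, neg_mul, mul_assoc _ (1 - 2 * f), hSB,
      mul_neg, neg_neg, mul_assoc])).eq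
  have hCB' : C * (x + star x) = (x + star x) * C :=
    (hCB _ ((Commute.refl _).mul_left (Commute.refl _))).eq
  have hSD : (1 - 2 * f) * (C + (x + star x)) = (C - (x + star x)) * (1 - 2 * f) := by
    rw [mul_add, hSB, ← hCS]; noncomm_ring
  have hDD : (C + (x + star x)) * (C - (x + star x)) = 0 := by
    rw [add_mul, mul_sub, mul_sub, hCC, hCB']; abel
  have hgB : (e₂ + f₂) * (x + star x) = x + star x := by
    have h1 : e₂ * x = 0 := by
      have : e₂ * f = 0 := by
        simpa [he₂.star_eq, hf.isSelfAdjoint.star_eq] using congrArg star hfe₂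
      rw [← hfx0, ← mul_assoc, this, zero_mul]
    have h2 : f₂ * star x = 0 := by
      have : f₂ * e = 0 := by
        simpa [hf₂.star_eq, he.isSelfAdjoint.star_eq] using congrArg star hef₂
      rw [← hexs0, ← mul_assoc, this, zero_mul]
    rw [add_mul, mul_add, mul_add, h1, hexs, hfx, h2]; abel
  have hgC : (e₂ + f₂) * C = C := by
    have hg : IsSelfAdjoint (e₂ + f₂) := he₂.add hf₂
    have h1 : (x + star x) * (1 - (e₂ + f₂)) = 0 := by
      have := congrArg star hgB
      rw [star_mul, hBs.star_eq, hg.star_eq] at this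
      rw [mul_sub, mul_one, this, sub_self]
    have h2 : C * (1 - (e₂ + f₂)) = 0 :=
      mul_eq_zero_of_mul_mul_eq_zero hC (by rw [hCC, mul_assoc, h1, mul_zero])
    have h3 := congrArg star h2
    rw [star_mul, hC.star_eq, star_sub, star_one, hg.star_eq, star_zero, sub_mul, one_mul,
      sub_eq_zero] at h3
    exact h3.symm
  have hgD : (e₂ + f₂) * (C + (x + star x)) = C + (x + star x) := by rw [mul_add, hgC, hgB]
  -- The range of `|B| + B`, for `B = x + x*`, lies in the graph of the polar part of `x`. The
  -- symmetry turns `C + B` into `C - B`, so `(C + B) * (C - B) = 0` is the isotropy. If `C + B`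
  -- vanished, `B` would both commute and anticommute with `1 - 2f`, forcing `x = 0`.
  refine ⟨C + (x + star x), add_mem hCA hBA, fun h0 => hx0 ?_, hgD, ?_⟩
  · have h1 : C = - (x + star x) := eq_neg_of_add_eq_zero_left h0
    rw [h1, mul_neg, hSB, neg_mul, neg_neg] at hCS
    have h2 : (2 : ℂ) • ((x + star x) * (1 - 2 * f)) = 0 := by
      rw [two_smul]; nth_rewrite 1 [← hCS]; abel
    have h3 := (smul_eq_zero.1 h2).resolve_left two_ne_zero
    rw [h3, neg_zero] at hSB
    have hf2 : f * f = f := hf.isIdempotentElem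
    calc x = f * x + f * star x := by rw [hfx0, hfxs0, add_zero]
      _ = - (f * ((1 - 2 * f) * (x + star x))) := by
        calc _ = - (f - 2 * f) * (x + star x) := by noncomm_ring
          _ = - (f - 2 * (f * f)) * (x + star x) := by rw [hf2]
          _ = _ := by noncomm_ring
      _ = 0 := by rw [hSB, mul_zero, neg_zero]
  · rw [(hC.add hBs).star_eq]
    have h1 : (e - f) * (e₂ + f₂) = (1 - 2 * f) * (e₂ + f₂) := by
      simp only [sub_mul, add_mul, mul_add, one_mul, hee, hef₂, hff, hfe₂, two_mul]
      abel
    rw [mul_assoc]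
    nth_rewrite 2 [← hgD]
    rw [← mul_assoc (e - f), h1, mul_assoc (1 - 2 * f), hgD, hSD, ← mul_assoc, hDD, zero_mul]

/-- Let `P` come from a maximal isotropic subspace `K`. As `P e P = P f P = P / 2`, the operator `2
f P e` is a partial isometry of `A` between subprojections of `e` and `f`. The leftovers have equal
trace; if they were nonzero, factoriality would link them by a nonzero element, and the isotropic
range built from it would enlarge `K`. -/
theorem IsFactor.mvNEquiv_of_trace_eq {A : VonNeumannAlgebra H} (hA : A.IsFactor)
    {τ : A.toStarSubalgebra →ₗ[ℂ] ℂ} (hτ : A.IsFaithfulNormalTrace τ) {e f : H →L[ℂ] H}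
    (he : e ∈ A.projections) (hf : f ∈ A.projections) (hef : e * f = 0)
    (hτef : τ ⟨e, he.1⟩ = τ ⟨f, hf.1⟩) : A.MvNEquiv e f := by
  obtain ⟨K, hK⟩ := A.exists_maximal_isIsotropic e f
  obtain ⟨P, ⟨hPA, hPp⟩, hPadd, hPsub, hPK⟩ := hK.prop.exists_projection
  have hP : IsSelfAdjoint P := hPp.isSelfAdjoint
  have hPP : P * P = P := hPp.isIdempotentElem
  have hee : e * e = e := he.2.isIdempotentElem
  have hff : f * f = f := hf.2.isIdempotentElem
  have hes : star e = e := he.2.isSelfAdjoint.star_eq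
  have hfs : star f = f := hf.2.isSelfAdjoint.star_eq
  have hfe : f * e = 0 := by simpa [hes, hfs] using congrArg star hef
  have h1 : P * e * P + P * f * P = P := by
    rw [← add_mul, ← mul_add, mul_assoc, hPadd, hPP]
  have h2 : P * e * P = P * f * P := by
    rw [← sub_eq_zero, ← sub_mul, ← mul_sub, hPsub]
  have hPe : 2 * (P * e * P) = P := by rw [two_mul]; nth_rewrite 2 [h2]; exact h1
  have hPf : 2 * (P * f * P) = P := by rw [← h2, hPe]
  have h2A : (2 : H →L[ℂ] H) ∈ A := by
    rw [← one_add_one_eq_two]; exact add_mem (one_mem A) (one_mem A)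
  have hs2 : star (2 : H →L[ℂ] H) = 2 := by
    rw [← one_add_one_eq_two, star_add, star_one]
  have hvA : 2 * f * P * e ∈ A := mul_mem (mul_mem (mul_mem h2A hf.1) hPA) he.1
  have hvs : star (2 * f * P * e) = 2 * e * P * f := by
    simp only [star_mul, hes, hfs, hP.star_eq, hs2]; noncomm_ring
  have hv1 : star (2 * f * P * e) * (2 * f * P * e) = 2 * (e * P * e) := by
    rw [hvs]
    calc 2 * e * P * f * (2 * f * P * e) = 2 * e * (2 * (P * (f * f) * P)) * e := by noncomm_ring
      _ = _ := by rw [hff, hPf]; noncomm_ring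
  have hv2 : (2 * f * P * e) * star (2 * f * P * e) = 2 * (f * P * f) := by
    rw [hvs]
    calc 2 * f * P * e * (2 * e * P * f) = 2 * f * (2 * (P * (e * e) * P)) * f := by noncomm_ring
      _ = _ := by rw [hee, hPe]; noncomm_ring
  have he₁A : 2 * (e * P * e) ∈ A := mul_mem h2A (mul_mem (mul_mem he.1 hPA) he.1)
  have hf₁A : 2 * (f * P * f) ∈ A := mul_mem h2A (mul_mem (mul_mem hf.1 hPA) hf.1)
  have he₂ : IsStarProjection (e - 2 * (e * P * e)) := by
    constructor
    · change (e - 2 * (e * P * e)) * (e - 2 * (e * P * e)) = _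
      calc (e - 2 * (e * P * e)) * (e - 2 * (e * P * e))
          = e * e - 2 * ((e * e) * P * e) - 2 * (e * P * (e * e))
            + 2 * (e * (2 * (P * (e * e) * P)) * e) := by noncomm_ring
        _ = _ := by rw [hee, hPe]; abel
    · rw [isSelfAdjoint_iff]
      simp only [star_sub, star_mul, hes, hP.star_eq, hs2]; noncomm_ring
  have hf₂ : IsStarProjection (f - 2 * (f * P * f)) := by
    constructor
    · change (f - 2 * (f * P * f)) * (f - 2 * (f * P * f)) = _
      calc (f - 2 * (f * P * f)) * (f - 2 * (f * P * f))
          = f * f - 2 * ((f * f) * P * f) - 2 * (f * P * (f * f))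
            + 2 * (f * (2 * (P * (f * f) * P)) * f) := by noncomm_ring
        _ = _ := by rw [hff, hPf]; abel
    · rw [isSelfAdjoint_iff]
      simp only [star_sub, star_mul, hfs, hP.star_eq, hs2]; noncomm_ring
  have he₂A := sub_mem he.1 he₁A
  have hf₂A := sub_mem hf.1 hf₁A
  have hτ₂ : τ ⟨_, he₂A⟩ = τ ⟨_, hf₂A⟩ := by
    rw [hτ.map_sub_eq he.1 he₁A he₂A rfl, hτ.map_sub_eq hf.1 hf₁A hf₂A rfl, hτef,
      hτ.map_eq_of_mul_comm (star_mem hvA) hvA he₁A hf₁A hv1 hv2]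
  refine ⟨_, hvA, ?_⟩
  rw [hv1, hv2]
  have hPe₂ : P * (e - 2 * (e * P * e)) = 0 := by
    calc P * (e - 2 * (e * P * e)) = P * e - (2 * (P * e * P)) * e := by noncomm_ring
      _ = 0 := by rw [hPe, sub_self]
  have hPf₂ : P * (f - 2 * (f * P * f)) = 0 := by
    calc P * (f - 2 * (f * P * f)) = P * f - (2 * (P * f * P)) * f := by noncomm_ring
      _ = 0 := by rw [hPf, sub_self]
  have hee₂ : e * (e - 2 * (e * P * e)) = e - 2 * (e * P * e) := by
    calc _ = e * e - 2 * ((e * e) * P * e) := by noncomm_ring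
      _ = _ := by rw [hee]
  have hff₂ : f * (f - 2 * (f * P * f)) = f - 2 * (f * P * f) := by
    calc _ = f * f - 2 * ((f * f) * P * f) := by noncomm_ring
      _ = _ := by rw [hff]
  -- The goal becomes the vanishing of both leftovers; by faithfulness and equality of traces,
  -- either one suffices.
  rw [eq_comm, ← sub_eq_zero, and_comm, eq_comm, ← sub_eq_zero]
  generalize e - 2 * (e * P * e) = e₂ at *
  generalize f - 2 * (f * P * f) = f₂ at *
  have he₂0 : f₂ = 0 → e₂ = 0 := fun h => by
    subst h
    exact hτ.eq_zero_of_map_eq_zero he₂A he₂ (by rw [hτ₂]; exact map_zero τ)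
  have hf₂0 : e₂ = 0 → f₂ = 0 := fun h => by
    subst h
    exact hτ.eq_zero_of_map_eq_zero hf₂A hf₂ (by rw [← hτ₂]; exact map_zero τ)
  suffices e₂ = 0 from ⟨hf₂0 this, this⟩
  by_contra hne
  obtain ⟨a, haA, ha⟩ := hA.exists_mul_mul_ne_zero hf₂A hne fun h => hne (he₂0 h)
  obtain ⟨D, hDA, hD0, hgD, hDD⟩ := exists_isotropic_range he.2 hf.2 hef
    (mul_mem (mul_mem hf₂A haA) he₂A) ha hee₂ hff₂
    (by rw [mul_assoc]; congr 1; exact he₂.isIdempotentElem)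
    (by rw [mul_assoc, ← mul_assoc f₂]; congr 1; exact hf₂.isIdempotentElem)
    he₂.isSelfAdjoint hf₂.isSelfAdjoint
  have hef₂ : e * f₂ = 0 := by rw [← hff₂, ← mul_assoc, hef, zero_mul]
  have hfe₂ : f * e₂ = 0 := by rw [← hee₂, ← mul_assoc, hfe, zero_mul]
  -- `P` kills `e₂` and `f₂`, and `e - f` preserves the range of `e₂ + f₂`, so the range of `D` is
  -- orthogonal to `K` both for the inner product and for the form.
  have hPD : P * D = 0 := by rw [← hgD, ← mul_assoc, mul_add, hPe₂, hPf₂, add_zero, zero_mul]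
  have hPgD : P * ((e - f) * D) = 0 := by
    rw [← hgD, ← mul_assoc, ← mul_assoc, mul_assoc P]
    have : (e - f) * (e₂ + f₂) = e₂ - f₂ := by
      rw [sub_mul, mul_add, mul_add, hee₂, hef₂, hfe₂, hff₂]; abel
    rw [this, mul_sub, hPe₂, hPf₂, sub_zero, zero_mul]
  have hgs : IsSelfAdjoint (e - f) := he.2.isSelfAdjoint.sub hf.2.isSelfAdjoint
  have hadj : ∀ (a : H →L[ℂ] H) (x y : H), inner ℂ (a x) y = inner ℂ x (star a y) := fun a x y =>
    (ContinuousLinearMap.adjoint_inner_right a x y).symm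
  have hcross : ∀ x ∈ K, ∀ w, inner ℂ x ((e - f) (D w)) = 0 := fun x hx w => by
    rw [← hPK x hx, hadj, hP.star_eq]
    have := DFunLike.congr_fun hPgD w
    change P ((e - f) (D w)) = 0 at this
    rw [this, inner_zero_right]
  have hle : K ⊔ D.range ≤ K := by
    refine hK.le_of_ge ⟨?_, ?_, ?_⟩ le_sup_left
    · intro x hx
      obtain ⟨x, hxK, _, ⟨w, rfl⟩, rfl⟩ := Submodule.mem_sup.1 hx
      have : (e + f) * D = D := by
        rw [← hgD, ← mul_assoc, add_mul, mul_add, mul_add, hee₂, hef₂, hfe₂, hff₂, add_zero,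
          zero_add]
      rw [map_add, hK.prop.add_apply x hxK]
      congr 1
      exact DFunLike.congr_fun this w
    · intro y hy x hx
      obtain ⟨x, hxK, _, ⟨w, rfl⟩, rfl⟩ := Submodule.mem_sup.1 hx
      rw [map_add]
      exact Submodule.add_mem_sup (hK.prop.apply_mem y hy x hxK)
        ⟨y w, (DFunLike.congr_fun (commute_of_mem_commutant hy hDA).eq w).symm⟩
    · intro x hx y hy
      obtain ⟨x, hxK, _, ⟨w, rfl⟩, rfl⟩ := Submodule.mem_sup.1 hx
      obtain ⟨y, hyK, _, ⟨u, rfl⟩, rfl⟩ := Submodule.mem_sup.1 hy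
      have h3 : inner ℂ (D w) ((e - f) y) = 0 := by
        rw [← hgs.star_eq, ← hadj, ← inner_conj_symm, hcross y hyK w, map_zero]
      have h4 : inner ℂ (D w) ((e - f) (D u)) = 0 := by
        rw [hadj]
        have := DFunLike.congr_fun hDD u
        change star D ((e - f) (D u)) = 0 at this
        rw [this, inner_zero_right]
      change inner ℂ (x + D w) ((e - f) (y + D u)) = 0
      rw [map_add, inner_add_left, inner_add_right, inner_add_right, h3, h4, hcross x hxK u,
        hK.prop.inner_eq_zero x hxK y hyK]
      simp
  apply hD0
  ext w
  rw [← hPK (D w) (hle (Submodule.mem_sup_right ⟨w, rfl⟩))]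
  exact DFunLike.congr_fun hPD w

/-! ### The direct rotation and its logarithm -/

/-- `U` is the product of the symmetries `Q` and `S`, so `S U S = U*` is automatic. The equivalence
`v` enters only on the kernel of `S + T`, where `v + v*` swaps the two infima and anticommutes with
`S`. -/
theorem exists_direct_rotation {A : VonNeumannAlgebra H} {p q : H →L[ℂ] H}
    (hp : p ∈ A.projections) (hq : q ∈ A.projections)
    (hef : A.MvNEquiv (projInf p (1 - q)) (projInf (1 - p) q)) :
    ∃ U ∈ A, star U * U = 1 ∧ U * star U = 1 ∧ 0 ≤ U + star U ∧
      U * (2 * p - 1) * star U = 2 * q - 1 ∧ (2 * p - 1) * U * (2 * p - 1) = star U := by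
  have heA := A.projInf_projections hp.1 (A.one_sub_mem' hq.1)
  have hfA := A.projInf_projections (A.one_sub_mem' hp.1) hq.1
  have hpe := mul_projInf_left (q := 1 - q) hp.2
  have hqe := mul_projInf_left (q := p) hq.2.one_sub
  have hpf := mul_projInf_left (q := q) hp.2.one_sub
  have hqf := mul_projInf_left (q := 1 - p) hq.2
  have hker := fun X => projInf_add_projInf_mul_eq (X := X) hp.2 hq.2
  rw [projInf_comm] at hqe hqf
  generalize projInf p (1 - q) = e at *
  generalize projInf (1 - p) q = f at *
  obtain ⟨v, hvA, hv1, hv2⟩ := hef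
  rw [sub_mul, one_mul, sub_eq_self] at hqe hpf
  have hee : e * e = e := heA.2.isIdempotentElem
  have hff : f * f = f := hfA.2.isIdempotentElem
  have hes : star e = e := heA.2.isSelfAdjoint.star_eq
  have hfs : star f = f := hfA.2.isSelfAdjoint.star_eq
  have hps : star p = p := hp.2.isSelfAdjoint.star_eq
  have hef0 : e * f = 0 := by
    have := congrArg star hpe
    rw [star_mul, hps, hes] at this
    rw [← this, mul_assoc, hpf, mul_zero]
  have hfe0 : f * e = 0 := by simpa [hes, hfs] using congrArg star hef0
  have hve : v * e = v := mul_eq_self_of_star_mul_self heA.2 hv1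
  have hfv : f * v = v := mul_eq_self_of_self_mul_star hfA.2 hv2
  have hevs : e * star v = star v := by simpa [hes] using congrArg star hve
  have hvsf : star v * f = star v := by simpa [hfs] using congrArg star hfv
  have hev : e * v = 0 := by rw [← hfv, ← mul_assoc, hef0, zero_mul]
  have hfvs : f * star v = 0 := by rw [← hevs, ← mul_assoc, hfe0, zero_mul]
  have hvv : v * v = 0 := by
    calc v * v = v * (e * v) := by rw [← mul_assoc, hve]
      _ = 0 := by rw [hev, mul_zero]
  have hvsvs : star v * star v = 0 := by rw [← star_mul, hvv, star_zero]
  have hpv : p * v = 0 := by rw [← hfv, ← mul_assoc, hpf, zero_mul]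
  have hqv : q * v = v := by rw [← hfv, ← mul_assoc, hqf]
  have hpvs : p * star v = star v := by rw [← hevs, ← mul_assoc, hpe]
  have hqvs : q * star v = 0 := by rw [← hevs, ← mul_assoc, hqe, zero_mul]
  have hvp : v * p = v := by simpa [hps] using congrArg star hpvs
  have hvsp : star v * p = 0 := by simpa [hps] using congrArg star hpv
  have hSA := two_mul_sub_one_mem hp.1
  have hS := isSelfAdjoint_two_mul_sub_one hp.2
  have hSS := two_mul_sub_one_mul_self hp.2
  obtain ⟨Q, hQA, hQ, hQQ, hQS, hQ0⟩ := A.exists_intertwining_symmetry (F := e + f)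
    (W := v + star v) hSA (two_mul_sub_one_mem hq.1) (add_mem heA.1 hfA.1)
    (add_mem hvA (star_mem hvA)) hS (isSelfAdjoint_two_mul_sub_one hq.2)
    (heA.2.isSelfAdjoint.add hfA.2.isSelfAdjoint) (IsSelfAdjoint.add_star_self v) hSS
    (two_mul_sub_one_mul_self hq.2)
    (by rw [add_mul, mul_add, mul_add, hee, hef0, hfe0, hff, add_zero, zero_add])
    (by
      calc (2 * p - 1 + (2 * q - 1)) * (e + f)
        = 2 * (p * e) + 2 * (q * e) + 2 * (p * f) + 2 * (q * f) - 2 * e - 2 * f := by noncomm_ring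
      _ = 0 := by rw [hpe, hqe, hpf, hqf]; simp)
    hker
    (by rw [add_mul, mul_add, mul_add, hev, hevs, hfv, hfvs]; abel)
    (by rw [add_mul, mul_add, mul_add, hvv, hvsvs, hv1, hv2]; abel)
    (by
      calc (v + star v) * (2 * p - 1) = 2 * (v * p) + 2 * (star v * p) - v - star v := by
            noncomm_ring
        _ = 2 * (q * v) + 2 * (q * star v) - v - star v := by rw [hvp, hvsp, hqv, hqvs]
        _ = _ := by noncomm_ring)
    (by
      calc (v + star v) * (2 * p - 1) + (2 * p - 1) * (v + star v)
          = 2 * (v * p) + 2 * (star v * p) + 2 * (p * v) + 2 * (p * star v)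
            - 2 * v - 2 * star v := by noncomm_ring
        _ = 0 := by rw [hvp, hvsp, hpv, hpvs]; simp)
  refine ⟨Q * (2 * p - 1), mul_mem hQA hSA, ?_⟩
  rw [star_mul, hQ.star_eq, hS.star_eq]
  generalize 2 * p - 1 = S at *
  refine ⟨?_, ?_, hQ0, ?_, ?_⟩
  · rw [mul_assoc, ← mul_assoc Q, hQQ, one_mul, hSS]
  · rw [mul_assoc, ← mul_assoc S, hSS, one_mul, hQQ]
  · rw [mul_assoc Q, hSS, mul_one, ← mul_assoc, hQS, mul_assoc, hQQ, mul_one]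
  · rw [mul_assoc S, mul_assoc Q, hSS, mul_one]

omit [CompleteSpace H] in
theorem norm_one_le' : ‖(1 : H →L[ℂ] H)‖ ≤ 1 := ContinuousLinearMap.norm_id_le

theorem norm_le_one_of_star_mul_self_eq_one {u : H →L[ℂ] H} (h : star u * u = 1) : ‖u‖ ≤ 1 := by
  have h1 := CStarRing.norm_star_mul_self (x := u)
  rw [h] at h1
  nlinarith [norm_one_le' (H := H), norm_nonneg u]

theorem norm_mul_mul_eq {u w a : H →L[ℂ] H} (hu : star u * u = 1) (hw : star w * w = 1)
    (hw' : w * star w = 1) : ‖u * a * w‖ = ‖a‖ := by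
  have h1 : ∀ {x : H →L[ℂ] H}, star x * x = 1 → ‖star x‖ ≤ 1 := fun h => by
    rw [norm_star]; exact norm_le_one_of_star_mul_self_eq_one h
  apply le_antisymm
  · calc ‖u * a * w‖ ≤ ‖u‖ * ‖a‖ * ‖w‖ := norm_mul₃_le
      _ ≤ 1 * ‖a‖ * 1 := by
        gcongr
        · exact norm_le_one_of_star_mul_self_eq_one hu
        · exact norm_le_one_of_star_mul_self_eq_one hw
      _ = ‖a‖ := by ring
  · calc ‖a‖ = ‖star u * (u * a * w) * star w‖ := by
          congr 1
          calc a = (star u * u) * a * (w * star w) := by rw [hu, hw', one_mul, mul_one]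
            _ = _ := by noncomm_ring
      _ ≤ ‖star u‖ * ‖u * a * w‖ * ‖star w‖ := norm_mul₃_le
      _ ≤ 1 * ‖u * a * w‖ * 1 := by
        gcongr
        · exact h1 hu
        · exact h1 hw
      _ = _ := by ring

/-- `(U - 1)*(U - 1) = 2 - (U + U*)`. The bound places the spectrum of `U` in the closed right half
circle, which limits the angle to `π / 2`. -/
theorem norm_sub_one_sq_le_two {U : H →L[ℂ] H} (hU : star U * U = 1) (h0 : 0 ≤ U + star U) :
    ‖U - 1‖ ^ 2 ≤ 2 := by
  have h1 : star (U - 1) * (U - 1) = 2 - (U + star U) := by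
    rw [star_sub, star_one, sub_mul, mul_sub, hU, ← one_add_one_eq_two]; noncomm_ring
  rw [sq, ← CStarRing.norm_star_mul_self,
    CStarAlgebra.norm_le_iff_le_algebraMap _ zero_le_two (star_mul_self_nonneg _), h1]
  have : algebraMap ℝ (H →L[ℂ] H) 2 = 2 := map_ofNat _ 2
  rw [this]
  exact sub_le_self _ h0

/-- The logarithm of the direct rotation. -/
theorem exists_angle_operator {A : VonNeumannAlgebra H} {S U : H →L[ℂ] H}
    (hS : IsSelfAdjoint S) (hSS : S * S = 1) (hUA : U ∈ A) (hU : star U * U = 1)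
    (hU' : U * star U = 1) (h0 : 0 ≤ U + star U) (hSU : S * U * S = star U) :
    ∃ x : selfAdjoint (H →L[ℂ] H), (x : H →L[ℂ] H) ∈ A ∧ ‖x‖ ≤ Real.pi / 2 ∧
      (selfAdjoint.expUnitary x : H →L[ℂ] H) = U ∧ S * x * S = - (x : H →L[ℂ] H) := by
  have hsq := norm_sub_one_sq_le_two hU h0
  have hlt : ‖U - 1‖ < 2 := by nlinarith [norm_nonneg (U - 1)]
  let Uu : unitary (H →L[ℂ] H) := ⟨U, hU, hU'⟩
  have hlt' : ‖(Uu - 1 : H →L[ℂ] H)‖ < 2 := hlt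
  have hexp := expUnitary_argSelfAdjoint hlt'
  have hnorm := Unitary.two_mul_one_sub_cos_norm_argSelfAdjoint hlt'
  have hpi := Unitary.norm_argSelfAdjoint_le_pi Uu
  have hle : ‖Unitary.argSelfAdjoint Uu‖ ≤ Real.pi / 2 := by
    by_contra! hgt
    have : Real.cos ‖Unitary.argSelfAdjoint Uu‖ < 0 :=
      Real.cos_neg_of_pi_div_two_lt_of_lt hgt (by linarith [Real.pi_pos])
    have h2 : ‖(Uu - 1 : H →L[ℂ] H)‖ ^ 2 ≤ 2 := hsq
    linarith
  have hmem : (Unitary.argSelfAdjoint Uu : H →L[ℂ] H) ∈ A :=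
    A.mem_of_commute_commutant fun y hy =>
      ((commute_of_mem_commutant hy hUA).symm.cfc
        (commute_of_mem_commutant hy (star_mem hUA)).symm _).symm
  generalize Unitary.argSelfAdjoint Uu = x at *
  refine ⟨x, hmem, hle, congrArg Subtype.val hexp, ?_⟩
  -- `e^{iy} = S U S = U* = e^{-ix}`, and both `y` and `-x` have norm below `π`, where a selfadjoint
  -- logarithm is unique.
  let y : selfAdjoint (H →L[ℂ] H) := ⟨S * x * S, by
    have := x.2.conjugate S
    rwa [hS.star_eq] at this⟩
  let Su : (H →L[ℂ] H)ˣ := ⟨S, S, hSS, hSS⟩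
  let _ : NormedAlgebra ℚ (H →L[ℂ] H) := NormedAlgebra.restrictScalars ℚ ℂ _
  have hy : selfAdjoint.expUnitary y = selfAdjoint.expUnitary (-x) := by
    have hn : selfAdjoint.expUnitary (-x) = star (selfAdjoint.expUnitary x) := by
      apply Subtype.ext
      rw [Unitary.coe_star, selfAdjoint.expUnitary_coe, selfAdjoint.expUnitary_coe,
        NormedSpace.star_exp, star_smul, x.2.star_eq]
      simp
    rw [hn]
    apply Subtype.ext
    rw [Unitary.coe_star, hexp]
    change _ = star U
    rw [← hSU, selfAdjoint.expUnitary_coe]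
    have h1 := NormedSpace.exp_units_conj Su (Complex.I • (x : H →L[ℂ] H))
    rw [← selfAdjoint.expUnitary_coe, hexp] at h1
    rw [← show Su * (Complex.I • (x : H →L[ℂ] H)) * (Su⁻¹ : (H →L[ℂ] H)ˣ) =
      Complex.I • (y : H →L[ℂ] H) by
        change S * (Complex.I • (x : H →L[ℂ] H)) * S = Complex.I • (S * x * S)
        rw [mul_smul_comm, smul_mul_assoc], h1]
    rfl
  have hyn : ‖y‖ < Real.pi := by
    have h2 : ‖(y : H →L[ℂ] H)‖ = ‖(x : H →L[ℂ] H)‖ :=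
      norm_mul_mul_eq (by rw [hS.star_eq, hSS]) (by rw [hS.star_eq, hSS]) (by rw [hS.star_eq, hSS])
    change ‖(y : H →L[ℂ] H)‖ < _
    rw [h2]
    exact hle.trans_lt (by linarith [Real.pi_pos])
  have hxn : ‖-x‖ < Real.pi := by
    rw [norm_neg]; exact hle.trans_lt (by linarith [Real.pi_pos])
  have := congrArg Unitary.argSelfAdjoint hy
  rw [argSelfAdjoint_expUnitary hyn, argSelfAdjoint_expUnitary hxn] at this
  exact congrArg Subtype.val this

/-! ### Curves on the sphere and the chord estimate -/

/-- A curve on the unit sphere of speed at most `2 * s`, where `2 * ∫ s < π`, ends at angle at most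
`2 * ∫ s` from its starting point. -/
theorem cos_integral_le_inner {E : Type*} [NormedAddCommGroup E] [InnerProductSpace ℝ E]
    {y y' : ℝ → E} {s : ℝ → ℝ} {a b : ℝ} (hab : a < b) (hs : Continuous s)
    (hy : ∀ t ∈ Icc a b, ‖y t‖ = 1)
    (hy' : ∀ t ∈ Icc a b, HasDerivWithinAt y (y' t) (Icc a b) t)
    (hys : ∀ t ∈ Icc a b, ‖y' t‖ ≤ 2 * s t) (hpi : 2 * ∫ t in a..b, s t < Real.pi) :
    Real.cos (2 * ∫ t in a..b, s t) ≤ inner ℝ (y a) (y b) := by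
  have hs0 : ∀ t ∈ Icc a b, 0 ≤ s t := fun t ht => by
    linarith [hys t ht, norm_nonneg (y' t)]
  have horth : ∀ t ∈ Icc a b, inner ℝ (y t) (y' t) = 0 := fun t ht => by
    have h1 := (hy' t ht).norm_sq
    have h2 : HasDerivWithinAt (‖y ·‖ ^ 2) 0 (Icc a b) t :=
      (hasDerivWithinAt_const t (Icc a b) (1 : ℝ)).congr (fun u hu => by simp [hy u hu])
        (by simp [hy t ht])
    have h3 := (uniqueDiffOn_Icc hab t ht).eq_deriv _ h1 h2
    linarith
  have hbound : ∀ t ∈ Icc a b, ∀ θ, 0 ≤ θ → θ ≤ Real.pi → inner ℝ (y a) (y t) = Real.cos θ →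
      - inner ℝ (y a) (y' t) ≤ 2 * s t * Real.sin θ := fun t ht θ h0 h1 hθ => by
    -- This vector is the component of `y a` orthogonal to `y t`. Since `y' t` is orthogonal to `y
    -- t`, only this component, of norm `sin θ`, is seen by `y' t`.
    have h2 : ‖y a - Real.cos θ • y t‖ ^ 2 = Real.sin θ ^ 2 := by
      rw [norm_sub_sq_real, inner_smul_right, hθ, norm_smul, hy a (left_mem_Icc.2 hab.le), hy t ht,
        Real.sin_sq, Real.norm_eq_abs, mul_one, sq_abs]
      ring
    have h3 : ‖y a - Real.cos θ • y t‖ = Real.sin θ :=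
      (sq_eq_sq₀ (norm_nonneg _) (Real.sin_nonneg_of_nonneg_of_le_pi h0 h1)).1 h2
    have h4 : inner ℝ (y a) (y' t) = inner ℝ (y a - Real.cos θ • y t) (y' t) := by
      rw [inner_sub_left, inner_smul_left, horth t ht, mul_zero, sub_zero]
    rw [h4, ← h3]
    calc _ ≤ ‖y a - Real.cos θ • y t‖ * ‖y' t‖ :=
          (neg_le_abs _).trans (abs_real_inner_le_norm _ _)
      _ ≤ ‖y a - Real.cos θ • y t‖ * (2 * s t) := by gcongr; exact hys t ht
      _ = _ := mul_comm _ _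
  have hl : ∀ t, HasDerivAt (fun u => ∫ r in a..u, s r) (s t) t := fun t =>
    hs.integral_hasStrictDerivAt a t |>.hasDerivAt
  have hl0 : ∀ t ∈ Icc a b, 0 ≤ ∫ r in a..t, s r := fun t ht =>
    intervalIntegral.integral_nonneg ht.1 fun u hu => hs0 u ⟨hu.1, hu.2.trans ht.2⟩
  have hlb : ∀ t ∈ Icc a b, ∫ r in a..t, s r ≤ ∫ r in a..b, s r := fun t ht => by
    rw [← intervalIntegral.integral_add_adjacent_intervals (hs.intervalIntegrable a t)
      (hs.intervalIntegrable t b), le_add_iff_nonneg_right]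
    exact intervalIntegral.integral_nonneg ht.2 fun u hu => hs0 u ⟨ht.1.trans hu.1, hu.2⟩
  -- Adding `ε * (1 + (t - a))` to the angle starts it at `ε > 0`, so its sine is positive at every
  -- contact time, and makes its rate exceed `2 * s t`. The derivative comparison is then strict;
  -- `ε` tends to `0` afterwards.
  have key : ∀ ε > 0, 2 * (∫ t in a..b, s t) + ε * (1 + (b - a)) < Real.pi →
      - inner ℝ (y a) (y b) ≤ - Real.cos (2 * (∫ t in a..b, s t) + ε * (1 + (b - a))) := by
    intro ε hε hεpi
    refine image_le_of_deriv_right_lt_deriv_boundary' (a := a) (b := b)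
      (f := fun t => - inner ℝ (y a) (y t)) (f' := fun t => - inner ℝ (y a) (y' t))
      (B := fun t => - Real.cos (2 * (∫ r in a..t, s r) + ε * (1 + (t - a))))
      (B' := fun t => Real.sin (2 * (∫ r in a..t, s r) + ε * (1 + (t - a))) * (2 * s t + ε))
      ?_ ?_ ?_ ?_ ?_ ?_ (right_mem_Icc.2 hab.le)
    · have : ContinuousOn y (Icc a b) := fun t ht => (hy' t ht).continuousWithinAt
      fun_prop
    · intro t ht
      have h1 : HasDerivWithinAt y (y' t) (Ici t) t :=
        (hy' t (Ico_subset_Icc_self ht)).mono_of_mem_nhdsWithin (Icc_mem_nhdsGE_of_mem ht)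
      have h2 := (hasDerivWithinAt_const t (Ici t) (y a)).inner ℝ h1
      rw [inner_zero_left, add_zero] at h2
      exact h2.neg
    · have h1 := Real.cos_le_one (2 * (∫ r in a..a, s r) + ε * (1 + (a - a)))
      simp only [real_inner_self_eq_norm_sq, hy a (left_mem_Icc.2 hab.le)]
      linarith
    · have : Continuous fun t => ∫ r in a..t, s r :=
        continuous_iff_continuousAt.2 fun t => (hl t).continuousAt
      fun_prop
    · intro t ht
      have h1 : HasDerivAt (fun t => 2 * (∫ r in a..t, s r) + ε * (1 + (t - a))) (2 * s t + ε) t := by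
        have := ((hl t).const_mul 2).add ((((hasDerivAt_id t).sub_const a).const_add 1).const_mul ε)
        rw [mul_one] at this
        exact this
      have h2 := h1.cos.neg
      rw [neg_mul, neg_neg] at h2
      exact h2.hasDerivWithinAt
    · intro t ht heq
      have ht' := Ico_subset_Icc_self ht
      have h1 := hl0 t ht'
      have h2 := hlb t ht'
      have h3 : 0 < ε * (1 + (t - a)) := by
        have := ht.1
        exact mul_pos hε (by linarith)
      have h4 : ε * (1 + (t - a)) ≤ ε * (1 + (b - a)) := by
        gcongr; exact ht.2.le
      have h5 := Real.sin_pos_of_pos_of_lt_pi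
        (x := 2 * (∫ r in a..t, s r) + ε * (1 + (t - a))) (by linarith) (by linarith)
      have h6 := hbound t ht' (2 * (∫ r in a..t, s r) + ε * (1 + (t - a))) (by linarith)
        (by linarith) (neg_injective heq)
      nlinarith
  have hlim : Filter.Tendsto (fun ε : ℝ =>
      - Real.cos (2 * (∫ t in a..b, s t) + ε * (1 + (b - a)))) (nhdsWithin 0 (Ioi 0))
      (nhds (- Real.cos (2 * ∫ t in a..b, s t))) := by
    have : Continuous fun ε : ℝ => - Real.cos (2 * (∫ t in a..b, s t) + ε * (1 + (b - a))) := by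
      fun_prop
    have h := this.tendsto 0
    simp only [zero_mul, add_zero] at h
    exact h.mono_left nhdsWithin_le_nhds
  have hev : ∀ᶠ ε : ℝ in nhdsWithin 0 (Ioi 0),
      2 * (∫ t in a..b, s t) + ε * (1 + (b - a)) < Real.pi := by
    have : Continuous fun ε : ℝ => 2 * (∫ t in a..b, s t) + ε * (1 + (b - a)) := by fun_prop
    have h := (this.tendsto 0).eventually_lt_const (u := Real.pi) (by simpa using hpi)
    exact h.filter_mono nhdsWithin_le_nhds
  exact neg_le_neg_iff.1 (ge_of_tendsto hlim (by
    filter_upwards [hev, self_mem_nhdsWithin] with ε h1 h2 using key ε h2 h1))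

omit [CompleteSpace H] in
theorem curveLength_nonneg (γ : ℝ → H →L[ℂ] H) {a b : ℝ} (hab : a ≤ b) :
    0 ≤ curveLength γ a b :=
  intervalIntegral.integral_nonneg hab fun _ _ => norm_nonneg _

theorem norm_symmetry_apply {p : H →L[ℂ] H} (hp : IsStarProjection p) (ξ : H) :
    ‖(2 * p - 1) ξ‖ = ‖ξ‖ := by
  have hS := isSelfAdjoint_two_mul_sub_one hp
  have h1 : star (2 * p - 1) * (2 * p - 1) = 1 := by
    rw [hS.star_eq, two_mul_sub_one_mul_self hp]
  have h2 := norm_le_one_of_star_mul_self_eq_one h1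
  apply le_antisymm
  · simpa using (2 * p - 1).le_of_opNorm_le h2 ξ
  · have h3 := (2 * p - 1).le_of_opNorm_le h2 ((2 * p - 1) ξ)
    have h4 : (2 * p - 1) ((2 * p - 1) ξ) = ξ :=
      DFunLike.congr_fun (two_mul_sub_one_mul_self hp) ξ
    rwa [h4, one_mul] at h3

/-- The chord of a short curve of projections, measured with the symmetries. -/
theorem norm_symmetry_sub_sq_le {γ : ℝ → H →L[ℂ] H} {a b : ℝ} (hab : a < b)
    (hγ : ContDiffOn ℝ 1 γ (Icc a b)) (hproj : ∀ t ∈ Icc a b, IsStarProjection (γ t))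
    (hpi : 2 * curveLength γ a b < Real.pi) :
    ‖(2 * γ b - 1) - (2 * γ a - 1)‖ ^ 2 ≤ 2 * (1 - Real.cos (2 * curveLength γ a b)) := by
  have hcont : ContinuousOn (fun t => ‖derivWithin γ (Icc a b) t‖) (Icc a b) :=
    (hγ.continuousOn_derivWithin (uniqueDiffOn_Icc hab) le_rfl).norm
  -- The speed, continued by its endpoint values to a continuous function on the whole line.
  let s : ℝ → ℝ := IccExtend hab.le ((Icc a b).domRestrict fun t => ‖derivWithin γ (Icc a b) t‖)
  have hs : Continuous s := (continuousOn_iff_continuous_domRestrict.1 hcont).Icc_extend'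
  have hst : ∀ t ∈ Icc a b, s t = ‖derivWithin γ (Icc a b) t‖ := fun t ht =>
    IccExtend_of_mem hab.le _ ht
  have hint : curveLength γ a b = ∫ t in a..b, s t :=
    intervalIntegral.integral_congr fun t ht => by
      rw [uIcc_of_le hab.le] at ht
      exact (hst t ht).symm
  have hc0 : 0 ≤ 2 * (1 - Real.cos (2 * curveLength γ a b)) := by
    linarith [Real.cos_le_one (2 * curveLength γ a b)]
  rw [← Real.le_sqrt (norm_nonneg _) hc0]
  refine ContinuousLinearMap.opNorm_le_of_unit_norm (Real.sqrt_nonneg _) fun ξ hξ => ?_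
  rw [Real.le_sqrt (norm_nonneg _) hc0]
  have hn : ∀ t ∈ Icc a b, ‖(2 * γ t - 1) ξ‖ = 1 := fun t ht => by
    rw [norm_symmetry_apply (hproj t ht), hξ]
  let _ : InnerProductSpace ℝ H := InnerProductSpace.rclikeToReal ℂ H
  have h := cos_integral_le_inner (y := fun t => (2 * γ t - 1) ξ)
    (y' := fun t => (2 * derivWithin γ (Icc a b) t) ξ) hab hs hn
    (fun t ht => by
      have h1 : HasDerivWithinAt γ (derivWithin γ (Icc a b) t) (Icc a b) t :=
        (hγ.differentiableOn one_ne_zero t ht).hasDerivWithinAt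
      have h2 := (h1.const_mul 2).sub_const 1
      exact ((ContinuousLinearMap.apply ℂ H ξ).restrictScalars ℝ).hasFDerivAt.comp_hasDerivWithinAt
        t h2)
    (fun t ht => by
      rw [hst t ht]
      have : (2 * derivWithin γ (Icc a b) t) ξ = (2 : ℝ) • derivWithin γ (Icc a b) t ξ := by
        rw [two_mul, two_smul]; rfl
      rw [this, norm_smul, Real.norm_two]
      have := (derivWithin γ (Icc a b) t).le_opNorm ξ
      rw [hξ, mul_one] at this
      linarith)
    (by rw [← hint]; exact hpi)
  rw [← hint] at h
  rw [_root_.sub_apply, norm_sub_sq_real, hn a (left_mem_Icc.2 hab.le),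
    hn b (right_mem_Icc.2 hab.le), real_inner_comm]
  linarith

/-! ### The curves `e^{tz} p e^{-tz}` as geodesics -/

theorem exp_mul_exp_neg (z : H →L[ℂ] H) : NormedSpace.exp z * NormedSpace.exp (-z) = 1 := by
  let _ : NormedAlgebra ℚ (H →L[ℂ] H) := NormedAlgebra.restrictScalars ℚ ℂ _
  rw [← NormedSpace.exp_add_of_commute (Commute.refl z).neg_right, add_neg_cancel,
    NormedSpace.exp_zero]

theorem exp_neg_mul_exp (z : H →L[ℂ] H) : NormedSpace.exp (-z) * NormedSpace.exp z = 1 := by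
  simpa using exp_mul_exp_neg (-z)

theorem star_exp_of_skew {z : H →L[ℂ] H} (hz : star z = -z) (t : ℝ) :
    star (NormedSpace.exp (t • z)) = NormedSpace.exp (-(t • z)) := by
  let _ : NormedAlgebra ℚ (H →L[ℂ] H) := NormedAlgebra.restrictScalars ℚ ℂ _
  rw [NormedSpace.star_exp, star_smul, hz, star_trivial, smul_neg]

theorem exp_mem {A : VonNeumannAlgebra H} {z : H →L[ℂ] H} (hz : z ∈ A) (t : ℝ) :
    NormedSpace.exp (t • z) ∈ A := by
  let _ : NormedAlgebra ℚ (H →L[ℂ] H) := NormedAlgebra.restrictScalars ℚ ℂ _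
  exact A.mem_of_commute_commutant fun y hy =>
    ((commute_of_mem_commutant hy hz).smul_right t).exp_right

theorem hasDerivAt_exp_conj (z Y : H →L[ℂ] H) (t : ℝ) :
    HasDerivAt (fun t : ℝ => NormedSpace.exp (t • z) * Y * NormedSpace.exp (-(t • z)))
      (NormedSpace.exp (t • z) * (z * Y - Y * z) * NormedSpace.exp (-(t • z))) t := by
  have h1 := hasDerivAt_exp_smul_const z t
  have h2 := hasDerivAt_exp_smul_const' (-z) t
  simp only [smul_neg] at h2
  have h3 := (h1.mul_const Y).mul h2
  refine h3.congr_deriv ?_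
  noncomm_ring

theorem contDiff_expCurve (z p : H →L[ℂ] H) {n : WithTop ℕ∞} : ContDiff ℝ n (expCurve z p) := by
  have h : ∀ w : H →L[ℂ] H, ContDiff ℝ n fun t : ℝ => NormedSpace.exp (t • w) := fun w =>
    (contDiff_iff_contDiffAt.2 fun x =>
      (NormedSpace.exp_analytic (𝕂 := ℝ) x).contDiffAt).comp (contDiff_id.smul contDiff_const)
  have h2 := ((h z).mul (contDiff_const (c := p))).mul (h (-z))
  simp only [smul_neg] at h2
  exact h2

/-- Every derivative is again a conjugate by `e^{tz}`, so identities at time `t` reduce to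
identities at time `0`. -/
theorem deriv_expCurve (z p : H →L[ℂ] H) :
    deriv (expCurve z p) = expCurve z (z * p - p * z) :=
  funext fun t => (hasDerivAt_exp_conj z p t).deriv

theorem expCurve_mem {A : VonNeumannAlgebra H} {z p : H →L[ℂ] H} (hp : p ∈ A.projections)
    (hzA : z ∈ A) (hz : star z = -z) (t : ℝ) : expCurve z p t ∈ A.projections := by
  have hm := exp_mem hzA t
  have hs := star_exp_of_skew hz t
  have hm' := star_mem hm
  rw [hs] at hm'
  refine ⟨mul_mem (mul_mem hm hp.1) hm', ?_, ?_⟩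
  · have hpp : p * p = p := hp.2.isIdempotentElem
    change NormedSpace.exp (t • z) * p * NormedSpace.exp (-(t • z)) *
      (NormedSpace.exp (t • z) * p * NormedSpace.exp (-(t • z))) = _
    calc _ = NormedSpace.exp (t • z) * p * (NormedSpace.exp (-(t • z)) *
          NormedSpace.exp (t • z)) * p * NormedSpace.exp (-(t • z)) := by noncomm_ring
      _ = NormedSpace.exp (t • z) * (p * p) * NormedSpace.exp (-(t • z)) := by
        rw [exp_neg_mul_exp]; noncomm_ring
      _ = _ := by rw [hpp]; rfl
  · have := hp.2.isSelfAdjoint.conjugate (NormedSpace.exp (t • z))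
    rwa [hs] at this

/-- `t ↦ e^{tz} p e^{-tz}` is a geodesic for codiagonal `z`. -/
theorem isGeodesic_expCurve {A : VonNeumannAlgebra H} {z p : H →L[ℂ] H} (hp : p ∈ A.projections)
    (hzA : z ∈ A) (hz : star z = -z) (hpz : p * z + z * p = z) :
    A.IsGeodesic (expCurve z p) := by
  refine ⟨contDiff_expCurve z p, expCurve_mem hp hzA hz, fun t => ?_⟩
  have hpp : p * p = p := hp.2.isIdempotentElem
  have hpzp : p * z * p = 0 := by
    have := congrArg (p * ·) hpz
    simpa [mul_add, ← mul_assoc, hpp] using this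
  have hzzp : p * (z * z) = z * z * p := by
    have h1 : p * z = z - z * p := eq_sub_of_add_eq hpz
    calc p * (z * z) = (p * z) * z := by noncomm_ring
      _ = z * z - z * (p * z) := by nth_rewrite 1 [h1]; noncomm_ring
      _ = z * z * p := by rw [h1]; noncomm_ring
  -- This double commutator is the acceleration transported back to time `0`. A codiagonal `z`
  -- exchanges the ranges of `p` and `1 - p`, so it commutes with `p` and has no codiagonal part.
  have hW : z * (z * p - p * z) - (z * p - p * z) * z =
      z * z * p + p * (z * z) - 2 * (z * p * z) := by noncomm_ring
  have hpzpz : p * (z * p * z) = 0 := by rw [← mul_assoc, ← mul_assoc, hpzp, zero_mul]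
  have hzpzp : z * p * z * p = 0 := by rw [mul_assoc z, mul_assoc z, hpzp, mul_zero]
  have hpW : p * (z * (z * p - p * z) - (z * p - p * z) * z) =
      (z * (z * p - p * z) - (z * p - p * z) * z) * p := by
    rw [hW]
    calc p * (z * z * p + p * (z * z) - 2 * (z * p * z))
        = p * (z * z) * p + p * p * (z * z) - 2 * (p * (z * p * z)) := by noncomm_ring
      _ = p * (z * z) * p + z * z * (p * p) - 2 * (z * p * z * p) := by
        rw [hpzpz, hzpzp, hpp, hzzp]
      _ = _ := by noncomm_ring
  unfold covariantDeriv
  rw [deriv_expCurve, deriv_expCurve]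
  generalize z * (z * p - p * z) - (z * p - p * z) * z = W at hpW
  have h1 : expCurve z p t * expCurve z W t = expCurve z (p * W) t := by
    unfold expCurve
    calc _ = NormedSpace.exp (t • z) * p * (NormedSpace.exp (-(t • z)) *
          NormedSpace.exp (t • z)) * W * NormedSpace.exp (-(t • z)) := by noncomm_ring
      _ = _ := by rw [exp_neg_mul_exp]; noncomm_ring
  have h2 : expCurve z W t * expCurve z p t = expCurve z (W * p) t := by
    unfold expCurve
    calc _ = NormedSpace.exp (t • z) * W * (NormedSpace.exp (-(t • z)) *
          NormedSpace.exp (t • z)) * p * NormedSpace.exp (-(t • z)) := by noncomm_ring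
      _ = _ := by rw [exp_neg_mul_exp]; noncomm_ring
  have h3 : expCurve z p t * expCurve z p t = expCurve z p t :=
    (expCurve_mem hp hzA hz t).2.isIdempotentElem
  have h4 : expCurve z p t * expCurve z W t = expCurve z W t * expCurve z p t := by
    rw [h1, h2, hpW]
  generalize expCurve z p t = P at *
  generalize expCurve z W t = V at *
  calc P * V * (1 - P) + (1 - P) * V * P
      = P * V - P * V * P + (V * P - P * (V * P)) := by noncomm_ring
    _ = 0 := by
      rw [← h4, ← mul_assoc P P, h3, h4, mul_assoc, h3]; abel

/-- For codiagonal `z` the commutator `z p - p z` equals `z (2p - 1)`, and `2p - 1` and `e^{tz}` are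
unitary. -/
theorem norm_deriv_expCurve {z p : H →L[ℂ] H} (hp : IsStarProjection p)
    (hz : star z = -z) (hpz : p * z + z * p = z) (t : ℝ) : ‖deriv (expCurve z p) t‖ = ‖z‖ := by
  have hS := isSelfAdjoint_two_mul_sub_one hp
  have hSS := two_mul_sub_one_mul_self hp
  have h1 : z * p - p * z = 1 * z * (2 * p - 1) := by
    calc z * p - p * z = 2 * (z * p) - (p * z + z * p) := by noncomm_ring
      _ = _ := by rw [hpz]; noncomm_ring
  have hs := star_exp_of_skew hz t
  rw [deriv_expCurve]
  unfold expCurve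
  rw [norm_mul_mul_eq (by rw [hs, exp_neg_mul_exp])
    (by rw [← hs, star_star, hs, exp_mul_exp_neg]) (by rw [← hs, star_star, hs, exp_neg_mul_exp]),
    h1, norm_mul_mul_eq (by simp) (by rw [hS.star_eq, hSS]) (by rw [hS.star_eq, hSS])]

theorem curveLength_expCurve {z p : H →L[ℂ] H} (hp : IsStarProjection p)
    (hz : star z = -z) (hpz : p * z + z * p = z) : curveLength (expCurve z p) 0 1 = ‖z‖ := by
  have : curveLength (expCurve z p) 0 1 = ∫ _ in (0 : ℝ)..1, ‖z‖ :=
    intervalIntegral.integral_congr fun t ht => by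
      rw [uIcc_of_le zero_le_one] at ht
      change ‖derivWithin (expCurve z p) (Icc 0 1) t‖ = ‖z‖
      have hd : DifferentiableAt ℝ (expCurve z p) t :=
        (hasDerivAt_exp_conj z p t).differentiableAt
      rw [hd.derivWithin (uniqueDiffOn_Icc zero_lt_one t ht)]
      exact norm_deriv_expCurve hp hz hpz t
  rw [this]; simp

/-! ### Minimality and existence of the geodesic -/

/-- A curve of projections from `p` to `q` has length at least `‖x‖ ≤ π / 2` when
`(2 * q - 1) * (2 * p - 1) = e^{2ix}`. -/
theorem norm_le_curveLength {p q : H →L[ℂ] H} {x : selfAdjoint (H →L[ℂ] H)}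
    (hp : IsStarProjection p) (hx : ‖x‖ ≤ Real.pi / 2)
    (hpq : (selfAdjoint.expUnitary (x + x) : H →L[ℂ] H) = (2 * q - 1) * (2 * p - 1))
    {γ : ℝ → H →L[ℂ] H} {a b : ℝ} (hab : a < b) (hγ : ContDiffOn ℝ 1 γ (Icc a b))
    (hproj : ∀ t ∈ Icc a b, IsStarProjection (γ t)) (ha : γ a = p) (hb : γ b = q) :
    ‖x‖ ≤ curveLength γ a b := by
  have hL0 := curveLength_nonneg γ hab.le
  by_contra! hlt
  have h1 := norm_symmetry_sub_sq_le hab hγ hproj (by linarith)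
  have hS := isSelfAdjoint_two_mul_sub_one hp
  have hSS := two_mul_sub_one_mul_self hp
  have hn2 : ‖x + x‖ = 2 * ‖x‖ := by
    change ‖(x : H →L[ℂ] H) + x‖ = 2 * ‖(x : H →L[ℂ] H)‖
    rw [← two_smul ℝ, norm_smul, Real.norm_two]
  have h2 := selfAdjoint.norm_sq_expUnitary_sub_one (x := x + x) (by linarith)
  -- The differences `T - S` and `T S - 1` have the same norm. Its square is at most `2(1 - cos 2L)`
  -- by the curve and exactly `2(1 - cos 2‖x‖)` by the angle, while the cosine decreases strictly on
  -- `[0, π]`.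
  have h3 : (2 * q - 1) * (2 * p - 1) - 1 = 1 * ((2 * q - 1) - (2 * p - 1)) * (2 * p - 1) := by
    rw [one_mul, sub_mul (2 * q - 1), hSS]
  rw [hpq, h3, norm_mul_mul_eq (by simp) (by rw [hS.star_eq, hSS]) (by rw [hS.star_eq, hSS]),
    hn2] at h2
  rw [ha, hb, h2] at h1
  have h4 := Real.cos_lt_cos_of_nonneg_of_le_pi (x := 2 * curveLength γ a b) (y := 2 * ‖x‖)
    (by linarith) (by linarith) (by linarith)
  linarith

/-- If `p ∧ (1 - q)` and `(1 - p) ∧ q` are equivalent in `A`, then `p` and `q` are unitarily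
equivalent and joined by a minimal normalized geodesic. -/
theorem exists_minimal_geodesic {A : VonNeumannAlgebra H} {p q : H →L[ℂ] H}
    (hp : p ∈ A.projections) (hq : q ∈ A.projections)
    (hef : A.MvNEquiv (projInf p (1 - q)) (projInf (1 - p) q)) :
    A.UnitaryEquiv p q ∧ ∃ z ∈ A.horizontal p, ‖z‖ ≤ Real.pi / 2 ∧
      A.IsNormalizedGeodesic (expCurve z p) ∧ expCurve z p 0 = p ∧ expCurve z p 1 = q ∧
      A.IsMinimalCurve (expCurve z p) := by
  obtain ⟨U, hUA, hU, hU', hU0, hUS, hSU⟩ := exists_direct_rotation hp hq hef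
  have hS := isSelfAdjoint_two_mul_sub_one hp.2
  have hSS := two_mul_sub_one_mul_self hp.2
  obtain ⟨x, hxA, hx, hxU, hSx⟩ := exists_angle_operator hS hSS hUA hU hU' hU0 hSU
  have hpp : p * p = p := hp.2.isIdempotentElem
  have htwo : ∀ {r s : H →L[ℂ] H}, 2 * r = 2 * s → r = s := fun {r s} h => by
    have h2 : (2 : ℂ) • (r - s) = 0 := by
      rw [smul_sub, two_smul, two_smul, ← two_mul, ← two_mul, h, sub_self]
    exact sub_eq_zero.1 ((smul_eq_zero.1 h2).resolve_left two_ne_zero)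
  have hUp : U * p * star U = q := htwo (by
    calc 2 * (U * p * star U) = U * (2 * p - 1) * star U + U * star U := by noncomm_ring
      _ = 2 * q := by rw [hUS, hU']; abel)
  refine ⟨⟨U, hUA, hU, hU', hUp⟩, ?_⟩
  have hzA : Complex.I • (x : H →L[ℂ] H) ∈ A := A.toStarSubalgebra.smul_mem hxA _
  have hz : star (Complex.I • (x : H →L[ℂ] H)) = - (Complex.I • (x : H →L[ℂ] H)) := by
    rw [star_smul, x.2.star_eq]; simp
  have hzn : ‖Complex.I • (x : H →L[ℂ] H)‖ = ‖x‖ := by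
    rw [norm_smul, Complex.norm_I, one_mul]; rfl
  have hSz : (2 * p - 1) * (Complex.I • (x : H →L[ℂ] H)) * (2 * p - 1) =
      - (Complex.I • (x : H →L[ℂ] H)) := by
    rw [mul_smul_comm, smul_mul_assoc, hSx, smul_neg]
  have hexp : NormedSpace.exp (Complex.I • (x : H →L[ℂ] H)) = U := by
    rw [← hxU, selfAdjoint.expUnitary_coe]
  -- From `T = U S U*` and `U* = S U S` follows `T S = U²`.
  have hV : (selfAdjoint.expUnitary (x + x) : H →L[ℂ] H) = (2 * q - 1) * (2 * p - 1) := by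
    let _ : NormedAlgebra ℚ (H →L[ℂ] H) := NormedAlgebra.restrictScalars ℚ ℂ _
    have h1 : Complex.I • ((x + x : selfAdjoint (H →L[ℂ] H)) : H →L[ℂ] H) =
        Complex.I • (x : H →L[ℂ] H) + Complex.I • (x : H →L[ℂ] H) := by
      exact smul_add _ _ _
    rw [selfAdjoint.expUnitary_coe, h1, NormedSpace.exp_add_of_commute (Commute.refl _), hexp,
      ← hUS, ← hSU]
    calc U * U = U * ((2 * p - 1) * (2 * p - 1)) * U * ((2 * p - 1) * (2 * p - 1)) := by
          rw [hSS, mul_one, mul_one]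
      _ = _ := by noncomm_ring
  generalize hzdef : Complex.I • (x : H →L[ℂ] H) = z at *
  have hpz : p * z + z * p = z := by
    have h1 : (2 * p - 1) * z = - (z * (2 * p - 1)) := by
      rw [← neg_mul, ← hSz, mul_assoc _ (2 * p - 1) (2 * p - 1), hSS, mul_one]
    exact htwo (by
      calc 2 * (p * z + z * p) = (2 * p - 1) * z + z * (2 * p - 1) + 2 * z := by noncomm_ring
        _ = 2 * z := by rw [h1]; abel)
  have hpzp : p * z * p = 0 := by
    have := congrArg (p * ·) hpz
    simpa [mul_add, ← mul_assoc, hpp] using this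
  have h0 : expCurve z p 0 = p := by simp [expCurve]
  have h1 : expCurve z p 1 = q := by
    have := star_exp_of_skew hz 1
    rw [one_smul] at this
    simp only [expCurve, one_smul]
    rw [← this, hexp, hUp]
  refine ⟨z, ⟨hzA, hz, hpzp, ?_⟩, hzn.trans_le hx, ⟨isGeodesic_expCurve hp hzA hz hpz, ?_⟩, h0, h1,
    ?_⟩
  · calc (1 - p) * z * (1 - p) = z - (p * z + z * p) + p * z * p := by noncomm_ring
      _ = 0 := by rw [hpz, hpzp]; abel
  · rw [norm_deriv_expCurve hp.2 hz hpz, hzn]; exact hx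
  · intro γ a b hab hγ hmem ha hb
    rw [curveLength_expCurve hp.2 hz hpz, hzn]
    exact norm_le_curveLength hp.2 hx hV hab hγ (fun t ht => (hmem t ht).2) (ha.trans h0)
      (hb.trans h1)

/-! ### The trace on connected components, and the equivalences -/

theorem IsFaithfulNormalTrace.map_eq_of_norm_sub_lt_one {A : VonNeumannAlgebra H}
    {τ : A.toStarSubalgebra →ₗ[ℂ] ℂ} (hτ : A.IsFaithfulNormalTrace τ) {p q : H →L[ℂ] H}
    (hp : p ∈ A.projections) (hq : q ∈ A.projections) (hpq : ‖p - q‖ < 1) :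
    τ ⟨p, hp.1⟩ = τ ⟨q, hq.1⟩ := by
  have hpp : p * p = p := hp.2.isIdempotentElem
  have hqq : q * q = q := hq.2.isIdempotentElem
  have hT := isSelfAdjoint_two_mul_sub_one hq.2
  have hTT := two_mul_sub_one_mul_self hq.2
  have hn : ‖-((2 * q - 1) * (p - q))‖ < 1 := by
    have : (2 * q - 1) * (p - q) = (2 * q - 1) * (p - q) * 1 := (mul_one _).symm
    rw [norm_neg, this, norm_mul_mul_eq (by rw [hT.star_eq, hTT]) (by simp) (by simp)]
    exact hpq
  -- This is `s = q p + (1 - q)(1 - p)`, which satisfies `s p = q s`. Written as `1 + (2q - 1)(p -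
  -- q)` it is invertible, because `2q - 1` is unitary and `‖p - q‖ < 1`.
  let s := Units.oneSub (-((2 * q - 1) * (p - q))) hn
  have hs : (s : H →L[ℂ] H) = 1 + (2 * q - 1) * (p - q) := by
    change 1 - -_ = _
    rw [sub_neg_eq_add]
  have hsA : (s : H →L[ℂ] H) ∈ A := by
    rw [hs]
    exact add_mem (one_mem A) (mul_mem (two_mul_sub_one_mem hq.1) (sub_mem hp.1 hq.1))
  have hsA' : ((s⁻¹ : (H →L[ℂ] H)ˣ) : H →L[ℂ] H) ∈ A := A.mem_of_commute_commutant fun y hy =>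
    (commute_of_mem_commutant hy hsA).units_inv_right
  have hsp : (s : H →L[ℂ] H) * p = q * s := by
    rw [hs]
    calc (1 + (2 * q - 1) * (p - q)) * p = p + 2 * q * (p * p) - p * p - 2 * (q * q) * p + q * p := by
          noncomm_ring
      _ = q + 2 * (q * q) * p - q * p - 2 * (q * q) * q + q * q := by
        rw [hpp, hqq, mul_assoc 2 q q, hqq]; noncomm_ring
      _ = q * (1 + (2 * q - 1) * (p - q)) := by noncomm_ring
  refine hτ.map_eq_of_mul_comm hsA' (mul_mem hsA hp.1) _ _ ?_ ?_
  · rw [← mul_assoc, Units.inv_mul, one_mul]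
  · rw [hsp, mul_assoc, Units.mul_inv, mul_one]

theorem IsFaithfulNormalTrace.map_eq_of_mem_connectedComponentIn {A : VonNeumannAlgebra H}
    {τ : A.toStarSubalgebra →ₗ[ℂ] ℂ} (hτ : A.IsFaithfulNormalTrace τ) {p q : H →L[ℂ] H}
    (hp : p ∈ A.projections) (hq : q ∈ A.projections)
    (h : q ∈ connectedComponentIn A.projections p) :
    τ ⟨p, hp.1⟩ = τ ⟨q, hq.1⟩ := by
  have hloc : IsLocallyConstant fun r : A.projections => τ ⟨r.1, r.2.1⟩ := by
    rw [IsLocallyConstant.iff_eventually_eq]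
    intro r
    filter_upwards [Metric.ball_mem_nhds r one_pos] with r' hr'
    refine hτ.map_eq_of_norm_sub_lt_one r'.2 r.2 ?_
    rw [← dist_eq_norm]; exact hr'
  rw [connectedComponentIn_eq_image hp] at h
  obtain ⟨q', hq', rfl⟩ := h
  exact hloc.apply_eq_of_isPreconnected isPreconnected_connectedComponent mem_connectedComponent hq'

theorem mem_connectedComponentIn_of_geodesic {A : VonNeumannAlgebra H} {δ : ℝ → H →L[ℂ] H}
    (hδ : A.IsGeodesic δ) (s t : ℝ) : δ t ∈ connectedComponentIn A.projections (δ s) :=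
  (isPreconnected_range hδ.smooth.continuous).subset_connectedComponentIn (mem_range_self s)
    (range_subset_iff.2 hδ.mem) (mem_range_self t)

theorem MvNEquiv.map_trace_eq {A : VonNeumannAlgebra H}
    {τ : A.toStarSubalgebra →ₗ[ℂ] ℂ} (hτ : A.IsFaithfulNormalTrace τ) {p q : H →L[ℂ] H}
    (hp : p ∈ A) (hq : q ∈ A) (h : A.MvNEquiv p q) : τ ⟨p, hp⟩ = τ ⟨q, hq⟩ := by
  obtain ⟨v, hvA, h1, h2⟩ := h
  exact hτ.map_eq_of_mul_comm (star_mem hvA) hvA hp hq h1 h2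

theorem UnitaryEquiv.mvNEquiv {A : VonNeumannAlgebra H} {p q : H →L[ℂ] H}
    (hp : p ∈ A.projections) (h : A.UnitaryEquiv p q) : A.MvNEquiv p q := by
  obtain ⟨u, huA, h1, -, h3⟩ := h
  have hpp : p * p = p := hp.2.isIdempotentElem
  refine ⟨u * p, mul_mem huA hp.1, ?_, ?_⟩
  · rw [star_mul, hp.2.isSelfAdjoint.star_eq, mul_assoc, ← mul_assoc (star u), h1, one_mul, hpp]
  · rw [star_mul, hp.2.isSelfAdjoint.star_eq, mul_assoc, ← mul_assoc p, hpp, ← mul_assoc, h3]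

/-- In a factor with a faithful normal trace, `τ p = τ q` makes `p ∧ (1 - q)` and `(1 - p) ∧ q`
equivalent. -/
theorem IsFactor.mvNEquiv_projInf {A : VonNeumannAlgebra H} (hA : A.IsFactor)
    {τ : A.toStarSubalgebra →ₗ[ℂ] ℂ} (hτ : A.IsFaithfulNormalTrace τ) {p q : H →L[ℂ] H}
    (hp : p ∈ A.projections) (hq : q ∈ A.projections) (h : τ ⟨p, hp.1⟩ = τ ⟨q, hq.1⟩) :
    A.MvNEquiv (projInf p (1 - q)) (projInf (1 - p) q) := by
  refine hA.mvNEquiv_of_trace_eq hτ (A.projInf_projections hp.1 (A.one_sub_mem' hq.1))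
    (A.projInf_projections (A.one_sub_mem' hp.1) hq.1) ?_ ?_
  · have h1 := congrArg star (mul_projInf_left (q := 1 - q) hp.2)
    rw [star_mul, hp.2.isSelfAdjoint.star_eq,
      (A.projInf_projections hp.1 (A.one_sub_mem' hq.1)).2.isSelfAdjoint.star_eq] at h1
    have h2 := mul_projInf_left (q := q) hp.2.one_sub
    rw [sub_mul, one_mul, sub_eq_self] at h2
    rw [← h1, mul_assoc, h2, mul_zero]
  · have h1 := hτ.map_sub_projInf hp hq
    rw [h] at h1
    exact sub_right_injective h1

end VonNeumannAlgebra

theorem mainTheorem2 {H : Type*} [NormedAddCommGroup H] [InnerProductSpace ℂ H] [CompleteSpace H]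
    (A : VonNeumannAlgebra H) (hfactor : A.IsFactor) (hfinite : A.IsFiniteAlgebra)
    (τ : A.toStarSubalgebra →ₗ[ℂ] ℂ) (hτ : A.IsFaithfulNormalTrace τ)
    (p q : H →L[ℂ] H) (hp : p ∈ A.projections) (hq : q ∈ A.projections) :
    [A.MvNEquiv p q,
      A.UnitaryEquiv p q,
      τ ⟨p, hp.1⟩ = τ ⟨q, hq.1⟩,
      q ∈ connectedComponentIn A.projections p].TFAE ∧
    (A.MvNEquiv p q →
      τ ⟨VonNeumannAlgebra.projInf p (1 - q), A.projInf_mem hp.1 (A.one_sub_mem' hq.1)⟩ =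
        τ ⟨VonNeumannAlgebra.projInf (1 - p) q, A.projInf_mem (A.one_sub_mem' hp.1) hq.1⟩ ∧
      ∃ z ∈ A.horizontal p, ‖z‖ ≤ Real.pi / 2 ∧
        A.IsNormalizedGeodesic (VonNeumannAlgebra.expCurve z p) ∧
        VonNeumannAlgebra.expCurve z p 0 = p ∧
        VonNeumannAlgebra.expCurve z p 1 = q ∧
        A.IsMinimalCurve (VonNeumannAlgebra.expCurve z p)) := by
  refine ⟨?_, fun h => ?_⟩
  · tfae_have 1 → 3 := fun h => h.map_trace_eq hτ hp.1 hq.1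
    tfae_have 3 → 2 := fun h =>
      (VonNeumannAlgebra.exists_minimal_geodesic hp hq (hfactor.mvNEquiv_projInf hτ hp hq h)).1
    tfae_have 2 → 1 := fun h => h.mvNEquiv hp
    tfae_have 3 → 4 := fun h => by
      obtain ⟨-, z, -, -, hg, h0, h1, -⟩ :=
        VonNeumannAlgebra.exists_minimal_geodesic hp hq (hfactor.mvNEquiv_projInf hτ hp hq h)
      have := VonNeumannAlgebra.mem_connectedComponentIn_of_geodesic hg.1 0 1
      rwa [h0, h1] at this
    tfae_have 4 → 3 := hτ.map_eq_of_mem_connectedComponentIn hp hq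
    tfae_finish
  · have hef := hfactor.mvNEquiv_projInf hτ hp hq (h.map_trace_eq hτ hp.1 hq.1)
    exact ⟨hef.map_trace_eq hτ _ _, (VonNeumannAlgebra.exists_minimal_geodesic hp hq hef).2⟩
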